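/- **Setting.** Let $\mathbb D$ be the open unit disk and $S^1$ the unit circle. Let $\Omega$ be a simply connected plane domain with $\mathbb D\subset\Omega\ne\mathbb C$ or, more generally, a connected Riemann surface spread without branching over $\mathbb C$ by a holomorphic local homeomorphism $\pi:\Omega\to\mathbb C$ (the coordinate $\omega$), which contains $\mathbb D$ on its first sheet, i.e. there is a continuous $\iota:\mathbb D\to\Omega$ with $\pi\circ\iota=\mathrm{id}$; in the plane case $\pi$ and $\iota$ are inclusions. Let $\mathcal B=S^1\cap\partial\Omega$ be the set of those $\omega\in S^1$ at which $\iota$ has no limit in $\Omega$ (in the plane case $\mathcal B=S^1\setminus\Omega$), and assume that $\mathcal B=\{\omega_1,\dots,\omega_M\}$ is finite. Let $\psi:\Omega\to\mathbb D$, $\psi(0)=0$, be a conformal (uniformization) map and $\varphi=\psi^{-1}$, read in the coordinate $\omega$ as a map $\mathbb D\to\mathbb C$. (If $\Omega$ is not simply connected, $\varphi$ is a holomorphic covering of $\Omega$ by $\mathbb D$ and $\psi$ is the branch of its inverse on the first sheet with $\psi(0)=0$.) On $\mathbb D$ we regard $\psi$ as a function of $\omega$, and extend it to points of $S^1$ by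 its limit from within $\mathbb D$, where that exists; it exists at all points of $S^1\setminus\mathcal B$. Let $\mathfrak b=\psi(S^1)$ denote the closure of $\psi(S^1\setminus\mathcal B)$. Let $r_0,r_1,\dots$ be independent random variables uniformly distributed on $[-1,1]$, let $\varepsilon>0$, and let $\mathcal N_\varepsilon(\omega)=\varepsilon\sum_{k\ge0}r_k\omega^k$ and $(\mathcal N_\varepsilon\circ\varphi)(z)=\sum_{k\ge 0}n_kz^k$ near $z=0$. A subset $C$ of the boundary of a domain $G$ is a *natural boundary* of a function $F$ if $F$ is holomorphic in $G$ and for no $\zeta\in C$ there is a function analytic in a neighbourhood of $\zeta$ that agrees with $F$ on the points of $G$ near $\zeta$. A set is an *analytic arc near* one of its points if some local biholomorphism at that point maps it, near that point, onto a piece of the real line. **Then:** 1. Almost surely, $S^1$ is a natural boundary of $\mathcal N_\varepsilon$ (on $\mathbb D$). 2. (a) Almost surely, $\mathfrak b$ is a natural boundary of $\mathcal N_\varepsilon\circ\varphi$ (on $\psi(\mathbb D)$). (b) $\mathfrak b$ is piecewise analytic, and the $\psi(\omega_i)$ are the only possible nonanalytic points: $\psi$ is injective on $S^1\setminus\mathcal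 B$, the map $\theta\mapsto\psi(e^{i\theta})$ is real-analytic with nonzero derivative wherever $e^{i\theta}\notin\mathcal B$, $\mathfrak b$ is an analytic arc near each point of $\psi(S^1\setminus\mathcal B)$, and $\mathfrak b\cap\mathbb D=\psi(S^1\setminus\mathcal B)$. (c) For each $i$, $|\psi(\omega)|\to1$ as $\omega\to\omega_i$ in $\overline{\mathbb D}\setminus\mathcal B$. If $\psi(\omega_i)=\lim_{\omega\to\omega_i,\ \omega\in\mathbb D}\psi(\omega)$ exists, then it lies on $\mathfrak b$; and if moreover $\omega_i$ is a singular point of $\psi$ (that is, $\psi|_{\mathbb D}$ does not continue analytically to a neighbourhood of $\omega_i$), then $\mathfrak b$ is not an analytic arc near $\psi(\omega_i)$. (d) If $\Omega$ is a simply connected plane domain, then $\psi$ extends continuously to $\overline{\mathbb D}$, $\mathfrak b$ is the image of $S^1$ under this extension, and $\{z\in\mathbb D:|\varphi(z)|=1\}=\psi(S^1\setminus\mathcal B)$. 3. $\min_{z\in\mathfrak b}|z|$ is attained, and every $z_{\rm inf}\in\mathfrak b$ with $|z_{\rm inf}|=\min_{z\in\mathfrak b}|z|$ satisfies $|z_{\rm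 inf}|<1$. 4. For every such $z_{\rm inf}$, almost surely $\displaystyle\limsup_{k\to\infty}|n_k|^{1/k}=|z_{\rm inf}|^{-1}$. -/

import Mathlib

open Set Filter Topology Metric MeasureTheory ProbabilityTheory
open scoped Manifold

noncomputable section

namespace NoiseSeries

/-! ### Analytic continuation, natural boundaries, analytic curves -/

/-- `F`, considered on `G`, continues analytically to a neighbourhood of `ζ`. -/
def IsRegularPoint (F : ℂ → ℂ) (G : Set ℂ) (ζ : ℂ) : Prop :=
  ∃ g : ℂ → ℂ, AnalyticAt ℂ g ζ ∧ F =ᶠ[𝓝[G] ζ] g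

/-- The part `C` of the boundary of the domain `G` is a natural boundary of `F`: `F` is holomorphic
in `G` and continues analytically across no point of `C`. -/
def IsNaturalBoundary (F : ℂ → ℂ) (G C : Set ℂ) : Prop :=
  IsOpen G ∧ IsConnected G ∧ DifferentiableOn ℂ F G ∧ C ⊆ frontier G ∧
    ∀ ζ ∈ C, ¬ IsRegularPoint F G ζ

/-- Near its point `p`, the set `C` is a regular analytic arc: a local biholomorphism at `p`
straightens it to a piece of the real line. -/
def IsAnalyticArcAt (C : Set ℂ) (p : ℂ) : Prop :=
  ∃ h : ℂ → ℂ, AnalyticAt ℂ h p ∧ deriv h p ≠ 0 ∧ (h p).im = 0 ∧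
    ∀ᶠ z in 𝓝 p, z ∈ C ↔ (h z).im = 0

/-! ### Riemann surfaces over the plane that contain the unit disk on the first sheet -/

/-- The structure of a Riemann surface `Ω` spread (without branching) over `ℂ` by the coordinate
`proj`, and containing the unit disk on its first sheet. A plane domain containing the unit disk is
the case in which `proj` is injective. -/
structure FirstSheet (Ω : Type*) [TopologicalSpace Ω] [ChartedSpace ℂ Ω] where
  /-- the coordinate `ω` on `Ω` -/
  proj : Ω → ℂ
  mdifferentiable_proj : MDifferentiable 𝓘(ℂ) 𝓘(ℂ) proj
  isLocalHomeomorph_proj : IsLocalHomeomorph proj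
  /-- the copy of the unit disk in `Ω`; only the values on the open unit disk matter -/
  sheet : ℂ → Ω
  continuousOn_sheet : ContinuousOn sheet (ball 0 1)
  proj_sheet : ∀ w ∈ ball (0 : ℂ) 1, proj (sheet w) = w

variable {Ω : Type*} [TopologicalSpace Ω] [ChartedSpace ℂ Ω]

/-- The set `S¹ ∩ ∂Ω`: the points of the unit circle at which the first sheet has no limit point
in `Ω`. (For a plane domain these are the points of the unit circle outside the domain.) -/
def FirstSheet.singularPoints (S : FirstSheet Ω) : Set ℂ :=
  {ω ∈ sphere (0 : ℂ) 1 | ¬ ∃ p : Ω, Tendsto S.sheet (𝓝[ball 0 1] ω) (𝓝 p)}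

/-- A uniformization of `Ω` by the unit disk, normalized at the origin of the first sheet: a
holomorphic covering map `unif` from the unit disk to `Ω`, together with its inverse `psi`. If `Ω`
is simply connected then `unif` is a biholomorphism and `psi` is its inverse map. In general `psi`
selects a branch of the inverse, continuous on the first sheet. -/
structure Uniformization (S : FirstSheet Ω) where
  /-- the covering map; only the values on the open unit disk matter -/
  unif : ℂ → Ω
  mdifferentiableOn_unif : MDifferentiableOn 𝓘(ℂ) 𝓘(ℂ) unif (ball 0 1)
  isCoveringMap_unif : IsCoveringMap (fun z : ball (0 : ℂ) 1 => unif z)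
  /-- the inverse `ψ` of the covering map -/
  psi : Ω → ℂ
  psi_mem : ∀ p, psi p ∈ ball (0 : ℂ) 1
  unif_psi : ∀ p, unif (psi p) = p
  continuousOn_psi : ContinuousOn psi (S.sheet '' ball 0 1)
  psi_zero : psi (S.sheet 0) = 0

namespace Uniformization

variable {S : FirstSheet Ω} (U : Uniformization S)

/-- The function `φ` on the unit disk: the inverse of `ψ`, read in the coordinate `ω`. -/
def phi (z : ℂ) : ℂ := S.proj (U.unif z)

/-- The function `ψ` on the first sheet, in the coordinate `ω`, with its boundary values: on the
open unit disk it is `ψ`, and at a point of the unit circle it is the limit of `ψ` from within the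
disk, where that exists. -/
def psiSheet : ℂ → ℂ := extendFrom (ball 0 1) (U.psi ∘ S.sheet)

/-- The domain `ψ(𝔻)`. -/
def imageDisk : Set ℂ := U.psiSheet '' ball 0 1

/-- The curve `ψ(S¹)`: the image of the part of the unit circle that lies in `Ω`, completed by its
limit points. -/
def boundaryCurve : Set ℂ := closure (U.psiSheet '' (sphere 0 1 \ S.singularPoints))

end Uniformization

/-! ### The noise series -/

/-- The noise series `ε ∑ r_k ω ^ k`. -/
def noise (ε : ℝ) (r : ℕ → ℝ) (w : ℂ) : ℂ := ∑' k : ℕ, (ε : ℂ) * (r k : ℂ) * w ^ k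

end NoiseSeries

end

noncomputable section

namespace NoiseSeries

/-! ### Branches of an inverse function on the disk -/

/-! The deterministic part uses only that `f` (that is, φ) is holomorphic and locally injective on
the disk, that `g` (that is, ψ on the first sheet) is a continuous right inverse of it, and that `B`
is finite. This is recorded in `DiskBranch`. If `g` has a cluster value inside the disk at some ω,
the local inverse of `f` there continues `g` analytically past ω (`exists_local_extension`). Hence
`g` extends across every point of the circle outside `B`, while compactness forces ‖g‖ → 1 at `B`.
Inside the disk, therefore, the boundary curve consists exactly of values at circle points outside
`B`, and near each of them it is the level set ‖f‖ = 1. At a point of `B`, analyticity of the curve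
would let Schwarz reflection continue `g`.

For the noise, fix ζ, δ and C. Flipping the signs of the coefficients over infinitely many disjoint
sets of multiples of a large n turns the event "C-Lipschitz near ζ" into equally likely events. On
the intersection of two of them the difference of the two series is a series in powers of w ^ n that
is Lipschitz near ζ. Rotation symmetry bounds its derivative on the whole disk, so its coefficients
tend to zero, which almost surely fails. Infinitely many equally likely, almost disjoint events are
null (`measure_lipschitzNoise`), and a countable union over ζ, δ and C makes the circle a natural
boundary.

The local inverses of φ carry this to the composition. The disk whose radius is the minimum of ‖z‖
on the curve lies in the image of `g`, and the Taylor series at 0 cannot converge on a larger disk,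
since its sum would continue the noise across a point of the circle. Cauchy–Hadamard then gives the
growth rate.

For a simply connected plane domain, ψ has limits at the points of `B` by an argument of Koebe type.
If ψ oscillated at ω, then φ would come close to the omitted value ω on connected sets near the
circle that sweep a fixed range of arguments. A bounded univalent companion of φ is small there, the
product of its rotations is small along every radius, and the area formula forces it to vanish at 0
(`eq_zero_of_rotations_radially_small`). -/

theorem eventually_extendFrom_mem_of_isClosed {X Y : Type*} [TopologicalSpace X]
    [TopologicalSpace Y] {A C : Set X} {f : X → Y} {x : X} {K : Set Y} (hK : IsClosed K)
    (hC : ∀ w ∈ C, w ∈ closure A ∧ ∃ y, Tendsto f (𝓝[A] w) (𝓝 y))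
    (h : ∀ᶠ w in 𝓝[A] x, f w ∈ K) : ∀ᶠ w in 𝓝[C] x, extendFrom A f w ∈ K := by
  rw [eventually_nhdsWithin_iff] at h ⊢
  filter_upwards [eventually_eventually_nhds.2 h] with w hw hwC
  have := mem_closure_iff_nhdsWithin_neBot.mp (hC w hwC).1
  exact hK.mem_of_tendsto (tendsto_extendFrom (hC w hwC).2) (eventually_nhdsWithin_iff.2 hw)

/-- The data of a holomorphic branch `g` on the unit disk of the inverse of a locally injective
holomorphic function `f` on the unit disk, where `B` is the finite set of the points of the
unit circle at which `g` has no limit inside the unit disk. -/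
structure DiskBranch (f g : ℂ → ℂ) (B : Set ℂ) : Prop where
  differentiableOn : DifferentiableOn ℂ f (ball 0 1)
  deriv_ne_zero : ∀ z ∈ ball (0 : ℂ) 1, deriv f z ≠ 0
  continuousOn : ContinuousOn g (ball 0 1)
  mapsTo : MapsTo g (ball 0 1) (ball 0 1)
  rightInv : ∀ w ∈ ball (0 : ℂ) 1, f (g w) = w
  map_zero : g 0 = 0
  mem_iff : ∀ ω, ω ∈ B ↔
    ω ∈ sphere (0 : ℂ) 1 ∧ ¬ ∃ z ∈ ball (0 : ℂ) 1, Tendsto g (𝓝[ball 0 1] ω) (𝓝 z)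
  finite : B.Finite

/-- Extension of a function from the unit disk by its boundary values. -/
abbrev diskExtend (g : ℂ → ℂ) : ℂ → ℂ := extendFrom (ball 0 1) g

/-- The closed curve of the boundary values of `g` outside `B`. -/
abbrev valueCurve (g : ℂ → ℂ) (B : Set ℂ) : Set ℂ := closure (diskExtend g '' (sphere 0 1 \ B))

namespace DiskBranch

variable {f g : ℂ → ℂ} {B : Set ℂ}

theorem analyticAt (H : DiskBranch f g B) {z : ℂ} (hz : z ∈ ball (0 : ℂ) 1) : AnalyticAt ℂ f z :=
  H.differentiableOn.analyticAt (isOpen_ball.mem_nhds hz)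

theorem differentiableOn_branch (H : DiskBranch f g B) : DifferentiableOn ℂ g (ball 0 1) := by
  intro w hw
  have hc : ContinuousAt g w := H.continuousOn.continuousAt (isOpen_ball.mem_nhds hw)
  have hd := (H.analyticAt (H.mapsTo hw)).differentiableAt.hasDerivAt
  refine (HasDerivAt.of_local_left_inverse hc hd (H.deriv_ne_zero _ (H.mapsTo hw))
    ?_).differentiableAt.differentiableWithinAt
  filter_upwards [isOpen_ball.mem_nhds hw] with y hy using H.rightInv y hy

theorem injOn_branch (H : DiskBranch f g B) : InjOn g (ball 0 1) := fun x hx y hy h => by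
  rw [← H.rightInv x hx, h, H.rightInv y hy]

/-- Since `f ∘ g` is the identity, a cluster value `z` satisfies `f z = ω`, and the local inverse of
`f` at `z` is the candidate `h`. A cluster value suffices: agreement of `g` and `h` near one point
spreads over the convex lens by the identity theorem. In particular, an interior cluster value is
automatically a limit. -/
theorem exists_local_extension (H : DiskBranch f g B) {ω z : ℂ}
    (hz : z ∈ ball (0 : ℂ) 1) (hcl : MapClusterPt z (𝓝[ball 0 1] ω) g) :
    ∃ (h : ℂ → ℂ) (r : ℝ), 0 < r ∧ DifferentiableOn ℂ h (ball ω r) ∧ h ω = z ∧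
      MapsTo h (ball ω r) (ball 0 1) ∧ (∀ w ∈ ball ω r, f (h w) = w) ∧
      (∀ᶠ z' in 𝓝 z, h (f z') = z') ∧ EqOn g h (ball ω r ∩ ball 0 1) := by
  have hfa := H.analyticAt hz
  have hfz : f z = ω := by
    have h1 : MapClusterPt (f z) (𝓝[ball 0 1] ω) (f ∘ g) :=
      hcl.continuousAt_comp hfa.continuousAt
    have h2 : Tendsto (f ∘ g) (𝓝[ball 0 1] ω) (𝓝 ω) := by
      refine (tendsto_id.mono_left nhdsWithin_le_nhds : Tendsto id (𝓝[ball 0 1] ω) (𝓝 ω)).congr' ?_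
      filter_upwards [self_mem_nhdsWithin] with w hw using (H.rightInv w hw).symm
    by_contra hne
    have hd := disjoint_nhds_nhds.2 hne
    exact (ClusterPt.mono h1 h2).ne (disjoint_iff.1 hd)
  have hd := H.deriv_ne_zero z hz
  set h := hfa.hasStrictDerivAt.localInverse _ _ _ hd with hh
  have hha : AnalyticAt ℂ h ω := hfz ▸ hfa.analyticAt_localInverse hd
  have hL : ∀ᶠ z' in 𝓝 z, h (f z') = z' := HasStrictDerivAt.eventually_left_inverse ..
  have hR : ∀ᶠ w in 𝓝 ω, f (h w) = w := by
    have := HasStrictDerivAt.eventually_right_inverse hfa.hasStrictDerivAt hd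
    rwa [hfz] at this
  have hω : h ω = z := by rw [← hfz]; exact hL.self_of_nhds
  have hm : ∀ᶠ w in 𝓝 ω, h w ∈ ball (0 : ℂ) 1 :=
    hha.continuousAt.eventually_mem (by rw [hω]; exact isOpen_ball.mem_nhds hz)
  obtain ⟨r, hr, hball⟩ := Metric.eventually_nhds_iff_ball.1
    (hha.eventually_analyticAt.and (hR.and hm))
  refine ⟨h, r, hr, fun w hw => (hball w hw).1.differentiableAt.differentiableWithinAt, hω,
    fun w hw => (hball w hw).2.2, fun w hw => (hball w hw).2.1, hL, ?_⟩
  -- On `V` the map `h` undoes `f`. Once `g` visits `V` at `w₀` it stays there near `w₀`, and `g = h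
  -- ∘ f ∘ g = h` there.
  obtain ⟨V, hV, hVo, hzV⟩ := _root_.eventually_nhds_iff.1 hL
  have hfr : ∃ᶠ w in 𝓝[ball 0 1] ω, g w ∈ V := hcl.frequently (hVo.mem_nhds hzV)
  have hev : ∀ᶠ w in 𝓝[ball 0 1] ω, w ∈ ball ω r ∩ ball 0 1 := by
    filter_upwards [self_mem_nhdsWithin, mem_nhdsWithin_of_mem_nhds (ball_mem_nhds ω hr)]
      with w h₁ h₂ using ⟨h₂, h₁⟩
  obtain ⟨w₀, hw₀V, hw₀⟩ := (hfr.and_eventually hev).exists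
  have hgd := H.differentiableOn_branch
  have hSo : IsOpen (ball ω r ∩ ball 0 1) := isOpen_ball.inter isOpen_ball
  refine AnalyticOnNhd.eqOn_of_preconnected_of_eventuallyEq (𝕜 := ℂ)
    (fun w hw => (hgd.analyticAt (isOpen_ball.mem_nhds hw.2)))
    (fun w hw => (hball w hw.1).1)
    ((convex_ball ω r).inter (convex_ball 0 1)).isPreconnected hw₀ ?_
  have hc : ContinuousAt g w₀ := H.continuousOn.continuousAt (isOpen_ball.mem_nhds hw₀.2)
  filter_upwards [hc.eventually_mem (hVo.mem_nhds hw₀V), isOpen_ball.mem_nhds hw₀.2] with w hw hw'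
  have := hV _ hw
  rw [H.rightInv w hw'] at this
  exact this.symm

end DiskBranch

end NoiseSeries

namespace NoiseSeries

/-! ### Boundary values of a branch -/

theorem mem_closure_unitBall {w : ℂ} (hw : w ∈ closedBall (0 : ℂ) 1) :
    w ∈ closure (ball (0 : ℂ) 1) := by
  rwa [closure_ball _ one_ne_zero]

theorem neBot_nhdsWithin_unitBall {w : ℂ} (hw : w ∈ closedBall (0 : ℂ) 1) :
    (𝓝[ball (0 : ℂ) 1] w).NeBot :=
  mem_closure_iff_nhdsWithin_neBot.mp (mem_closure_unitBall hw)

theorem frequently_mem_unitSphere {ω : ℂ} (hω : ω ∈ sphere (0 : ℂ) 1) :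
    ∃ᶠ w in 𝓝[≠] ω, w ∈ sphere (0 : ℂ) 1 := by
  have hpc : IsPreconnected (sphere (0 : ℂ) 1) :=
    isPreconnected_sphere (by rw [Complex.rank_real_complex]; exact Nat.one_lt_ofNat) 0 1
  have hnt : (sphere (0 : ℂ) 1).Nontrivial :=
    ⟨1, by simp, -1, by simp, by norm_num⟩
  have hacc : AccPt ω (𝓟 (sphere (0 : ℂ) 1)) := hpc.preperfect_of_nontrivial hnt ω hω
  rwa [accPt_iff_frequently_nhdsNE] at hacc

namespace DiskBranch

variable {f g : ℂ → ℂ} {B : Set ℂ}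

theorem exists_tendsto (H : DiskBranch f g B) {ω : ℂ} (hω : ω ∈ closedBall (0 : ℂ) 1)
    (hB : ω ∉ B) : ∃ z ∈ ball (0 : ℂ) 1, Tendsto g (𝓝[ball 0 1] ω) (𝓝 z) := by
  by_cases hb : ω ∈ ball (0 : ℂ) 1
  · exact ⟨g ω, H.mapsTo hb, H.continuousOn ω hb⟩
  · have hs : ω ∈ sphere (0 : ℂ) 1 := by
      simp only [mem_closedBall, mem_ball, mem_sphere] at *
      exact le_antisymm hω (not_lt.1 hb)
    by_contra h
    exact hB ((H.mem_iff ω).2 ⟨hs, h⟩)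

theorem subset_sphere (H : DiskBranch f g B) : B ⊆ sphere 0 1 := fun ω h => ((H.mem_iff ω).1 h).1

/-- This is the working form of the local extension: the boundary values of `g` are themselves
values of `h`, because `h` is the limit of `g` at every nearby point of the closed disk. -/
theorem exists_chart (H : DiskBranch f g B) {ω : ℂ} (hω : ω ∈ closedBall (0 : ℂ) 1)
    (hB : ω ∉ B) : ∃ (h : ℂ → ℂ) (r : ℝ), 0 < r ∧ DifferentiableOn ℂ h (ball ω r) ∧
      MapsTo h (ball ω r) (ball 0 1) ∧ (∀ w ∈ ball ω r, f (h w) = w) ∧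
      (∀ᶠ z' in 𝓝 (h ω), h (f z') = z') ∧
      EqOn (diskExtend g) h (ball ω r ∩ closedBall 0 1) ∧ ball ω r ⊆ Bᶜ := by
  obtain ⟨z, hz, hlim⟩ := H.exists_tendsto hω hB
  have := neBot_nhdsWithin_unitBall hω
  obtain ⟨h, r, hr, hd, hωz, hm, hR, hL, hE⟩ := H.exists_local_extension hz hlim.mapClusterPt
  have key : ∀ w ∈ ball ω r, Tendsto g (𝓝[ball 0 1] w) (𝓝 (h w)) := by
    intro w hw
    have hc : ContinuousAt h w := hd.continuousOn.continuousAt (isOpen_ball.mem_nhds hw)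
    refine (hc.tendsto.mono_left nhdsWithin_le_nhds).congr' ?_
    filter_upwards [self_mem_nhdsWithin, mem_nhdsWithin_of_mem_nhds (isOpen_ball.mem_nhds hw)]
      with y h₁ h₂ using (hE ⟨h₂, h₁⟩).symm
  refine ⟨h, r, hr, hd, hm, hR, hωz ▸ hL, fun w hw => ?_, fun w hw hwB => ?_⟩
  · exact extendFrom_eq (mem_closure_unitBall hw.2) (key w hw.1)
  · exact ((H.mem_iff w).1 hwB).2 ⟨h w, hm hw, key w hw⟩

theorem diskExtend_of_mem (H : DiskBranch f g B) {w : ℂ} (hw : w ∈ ball (0 : ℂ) 1) :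
    diskExtend g w = g w :=
  extendFrom_extends H.continuousOn w hw

theorem diskExtend_mem (H : DiskBranch f g B) {w : ℂ} (hw : w ∈ closedBall (0 : ℂ) 1)
    (hB : w ∉ B) : diskExtend g w ∈ ball (0 : ℂ) 1 := by
  obtain ⟨h, r, hr, -, hm, -, -, hE, -⟩ := H.exists_chart hw hB
  rw [hE ⟨mem_ball_self hr, hw⟩]
  exact hm (mem_ball_self hr)

theorem apply_diskExtend (H : DiskBranch f g B) {w : ℂ} (hw : w ∈ closedBall (0 : ℂ) 1)
    (hB : w ∉ B) : f (diskExtend g w) = w := by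
  obtain ⟨h, r, hr, -, -, hR, -, hE, -⟩ := H.exists_chart hw hB
  rw [hE ⟨mem_ball_self hr, hw⟩]
  exact hR w (mem_ball_self hr)

theorem continuousOn_diskExtend (H : DiskBranch f g B) :
    ContinuousOn (diskExtend g) (closedBall 0 1 \ B) :=
  continuousOn_extendFrom (fun _ hw => mem_closure_unitBall hw.1) fun _ hw =>
    let ⟨z, _, h⟩ := H.exists_tendsto hw.1 hw.2
    ⟨z, h⟩

theorem injOn_diskExtend (H : DiskBranch f g B) :
    InjOn (diskExtend g) (closedBall 0 1 \ B) := fun x hx y hy h => by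
  rw [← H.apply_diskExtend hx.1 hx.2, h, H.apply_diskExtend hy.1 hy.2]

theorem eventually_mem_of_isClosed (H : DiskBranch f g B) {ω : ℂ} {K : Set ℂ} (hK : IsClosed K)
    (h : ∀ᶠ w in 𝓝[ball 0 1] ω, g w ∈ K) :
    ∀ᶠ w in 𝓝[closedBall 0 1 \ B] ω, diskExtend g w ∈ K :=
  eventually_extendFrom_mem_of_isClosed hK (fun _ hw => ⟨mem_closure_unitBall hw.1,
    let ⟨z, _, h⟩ := H.exists_tendsto hw.1 hw.2
    ⟨z, h⟩⟩) h

/-- If `g` kept returning to a smaller closed disk, compactness would give a cluster value inside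
the unit disk, hence a limit there, contrary to `ω ∈ B`. -/
theorem tendsto_norm_branch (H : DiskBranch f g B) {ω : ℂ} (hω : ω ∈ B) :
    Tendsto (fun w => ‖g w‖) (𝓝[ball 0 1] ω) (𝓝 1) := by
  refine tendsto_order.2 ⟨fun a ha => ?_, fun a ha => ?_⟩
  · by_contra hcon
    have hfr : ∃ᶠ w in 𝓝[ball 0 1] ω, g w ∈ closedBall (0 : ℂ) a := by
      rw [not_eventually] at hcon
      exact hcon.mono fun w hw => mem_closedBall_zero_iff.2 (not_lt.1 hw)
    obtain ⟨z, hz, hcl⟩ := (isCompact_closedBall (0 : ℂ) a).exists_mapClusterPt_of_frequently hfr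
    have hzb : z ∈ ball (0 : ℂ) 1 := closedBall_subset_ball ha hz
    obtain ⟨h, r, hr, hd, hωz, hm, hR, hL, hE⟩ := H.exists_local_extension hzb hcl
    refine ((H.mem_iff ω).1 hω).2 ⟨z, hzb, ?_⟩
    have hc : ContinuousAt h ω := hd.continuousOn.continuousAt (ball_mem_nhds ω hr)
    rw [← hωz]
    refine (hc.tendsto.mono_left nhdsWithin_le_nhds).congr' ?_
    filter_upwards [self_mem_nhdsWithin, mem_nhdsWithin_of_mem_nhds (ball_mem_nhds ω hr)]
      with y h₁ h₂ using (hE ⟨h₂, h₁⟩).symm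
  · filter_upwards [self_mem_nhdsWithin] with w hw
    have := H.mapsTo hw
    rw [mem_ball_zero_iff] at this
    exact this.trans ha

theorem tendsto_norm_diskExtend (H : DiskBranch f g B) {ω : ℂ} (hω : ω ∈ B) :
    Tendsto (fun w => ‖diskExtend g w‖) (𝓝[closedBall 0 1 \ B] ω) (𝓝 1) := by
  refine tendsto_order.2 ⟨fun a ha => ?_, fun a ha => ?_⟩
  -- Only closed conditions pass to boundary values, so the strict bound goes through an
  -- intermediate `b`.
  · obtain ⟨b, hab, hb⟩ := exists_between ha
    have := H.eventually_mem_of_isClosed (ω := ω) (K := {z : ℂ | b ≤ ‖z‖})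
      (isClosed_le continuous_const continuous_norm)
      (((tendsto_order.1 (H.tendsto_norm_branch hω)).1 b hb).mono fun w hw => hw.le)
    exact this.mono fun w hw => hab.trans_le hw
  · filter_upwards [self_mem_nhdsWithin] with w hw
    have := H.diskExtend_mem hw.1 hw.2
    rw [mem_ball_zero_iff] at this
    exact this.trans ha

theorem tendsto_diskExtend (H : DiskBranch f g B) {ω ζ : ℂ}
    (h : Tendsto g (𝓝[ball 0 1] ω) (𝓝 ζ)) :
    Tendsto (diskExtend g) (𝓝[closedBall 0 1 \ B] ω) (𝓝 ζ) := by
  rw [(nhds_basis_closedBall (x := ζ)).tendsto_right_iff]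
  intro ε hε
  exact H.eventually_mem_of_isClosed isClosed_closedBall
    (h.eventually_mem (closedBall_mem_nhds ζ hε))

theorem eventually_notMem (H : DiskBranch f g B) (ω : ℂ) : ∀ᶠ w in 𝓝[≠] ω, w ∉ B := by
  have : (B \ {ω})ᶜ ∈ 𝓝 ω :=
    ((H.finite.subset sdiff_subset).isClosed.isOpen_compl).mem_nhds (by simp)
  filter_upwards [self_mem_nhdsWithin, mem_nhdsWithin_of_mem_nhds this] with w h₁ h₂ h₃
  exact h₂ ⟨h₃, h₁⟩

theorem mem_closure_sphere_diff (H : DiskBranch f g B) {ω : ℂ} (hω : ω ∈ sphere (0 : ℂ) 1) :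
    ω ∈ closure (sphere 0 1 \ B) := by
  rw [mem_closure_iff_frequently]
  exact ((frequently_mem_unitSphere hω).and_eventually (H.eventually_notMem ω)).filter_mono
    nhdsWithin_le_nhds

theorem mem_valueCurve (H : DiskBranch f g B) {ω ζ : ℂ} (hω : ω ∈ sphere (0 : ℂ) 1)
    (h : Tendsto g (𝓝[ball 0 1] ω) (𝓝 ζ)) : ζ ∈ valueCurve g B := by
  have := mem_closure_iff_nhdsWithin_neBot.mp (H.mem_closure_sphere_diff hω)
  refine mem_closure_of_tendsto ((H.tendsto_diskExtend h).mono_left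
    (nhdsWithin_mono ω (sdiff_subset_sdiff_left sphere_subset_closedBall))) ?_
  filter_upwards [self_mem_nhdsWithin] with w hw using mem_image_of_mem _ hw

/-- A properness argument: a limit of preimages cannot lie in `B`, since the norms of the values
would then tend to 1. Elsewhere the extended branch is continuous. -/
theorem exists_of_mem_closure_image (H : DiskBranch f g B) {z : ℂ} {A : Set ℂ}
    (hA : A ⊆ closedBall 0 1 \ B) (hz : z ∈ closure (diskExtend g '' A)) (hz1 : ‖z‖ < 1) :
    ∃ w ∈ closure A \ B, diskExtend g w = z := by
  obtain ⟨u, hu, hlim⟩ := mem_closure_iff_seq_limit.1 hz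
  choose a ha hau using hu
  obtain ⟨w, hw, φ, hφ, haw⟩ := (isCompact_closedBall (0 : ℂ) 1).tendsto_subseq
    fun n => (hA (ha n)).1
  have hlim' : Tendsto (fun n => diskExtend g (a (φ n))) atTop (𝓝 z) := by
    simp_rw [hau]
    exact hlim.comp hφ.tendsto_atTop
  have haw' : Tendsto (a ∘ φ) atTop (𝓝[closedBall 0 1 \ B] w) :=
    tendsto_nhdsWithin_iff.2 ⟨haw, Eventually.of_forall fun n => hA (ha _)⟩
  have hwB : w ∉ B := fun hwB =>
    hz1.ne (tendsto_nhds_unique hlim'.norm ((H.tendsto_norm_diskExtend hwB).comp haw'))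
  exact ⟨w, ⟨mem_closure_of_tendsto haw (Eventually.of_forall fun n => ha _), hwB⟩,
    tendsto_nhds_unique ((H.continuousOn_diskExtend w ⟨hw, hwB⟩).tendsto.comp haw') hlim'⟩

theorem valueCurve_inter_ball (H : DiskBranch f g B) :
    valueCurve g B ∩ ball 0 1 = diskExtend g '' (sphere 0 1 \ B) := by
  refine Subset.antisymm ?_ fun z hz => ⟨subset_closure hz, ?_⟩
  · rintro z ⟨hz, hz1⟩
    obtain ⟨w, hw, rfl⟩ := H.exists_of_mem_closure_image
      (sdiff_subset_sdiff_left sphere_subset_closedBall) hz (mem_ball_zero_iff.1 hz1)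
    exact mem_image_of_mem _ ⟨closure_minimal sdiff_subset isClosed_sphere hw.1, hw.2⟩
  · obtain ⟨w, hw, rfl⟩ := hz
    exact H.diskExtend_mem (sphere_subset_closedBall hw.1) hw.2

theorem isOpen_image (H : DiskBranch f g B) : IsOpen (g '' ball 0 1) := by
  have hga : AnalyticOnNhd ℂ g (ball 0 1) := H.differentiableOn_branch.analyticOnNhd isOpen_ball
  rcases hga.is_constant_or_isOpen (convex_ball 0 1).isPreconnected with ⟨c, hc⟩ | h
  · have h₁ : (0 : ℂ) ∈ ball (0 : ℂ) 1 := by simp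
    have h₂ : (1 / 2 : ℂ) ∈ ball (0 : ℂ) 1 := by
      rw [mem_ball_zero_iff]; norm_num
    have := H.injOn_branch h₁ h₂ (by rw [hc _ h₁, hc _ h₂])
    norm_num at this
  · exact h _ Subset.rfl isOpen_ball

theorem isConnected_image (H : DiskBranch f g B) : IsConnected (g '' ball 0 1) :=
  ((convex_ball (0 : ℂ) 1).isConnected (nonempty_ball.2 one_pos)).image _ H.continuousOn

theorem ball_subset (H : DiskBranch f g B) : ball (0 : ℂ) 1 ⊆ closedBall 0 1 \ B := fun _ hw =>
  ⟨ball_subset_closedBall hw, fun hB => by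
    have := H.subset_sphere hB
    rw [mem_sphere] at this
    exact (mem_ball.1 hw).ne this⟩

theorem image_diskExtend (H : DiskBranch f g B) : diskExtend g '' ball 0 1 = g '' ball 0 1 :=
  image_congr fun _ hw => H.diskExtend_of_mem hw

theorem valueCurve_subset_frontier (H : DiskBranch f g B) :
    valueCurve g B ⊆ frontier (g '' ball 0 1) := by
  refine closure_minimal ?_ isClosed_frontier
  rintro _ ⟨ω, hω, rfl⟩
  have hω' : ω ∈ closedBall (0 : ℂ) 1 := sphere_subset_closedBall hω.1
  rw [H.isOpen_image.frontier_eq]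
  constructor
  · obtain ⟨z, hz, hlim⟩ := H.exists_tendsto hω' hω.2
    have := neBot_nhdsWithin_unitBall hω'
    refine mem_closure_of_tendsto (tendsto_extendFrom ⟨z, hlim⟩) ?_
    filter_upwards [self_mem_nhdsWithin] with w hw using mem_image_of_mem _ hw
  · rintro ⟨w, hw, h⟩
    rw [← H.diskExtend_of_mem hw] at h
    have := H.injOn_diskExtend (H.ball_subset hw) ⟨hω', hω.2⟩ h
    rw [this] at hw
    exact (mem_ball.1 hw).ne hω.1

theorem sphere_diff_nonempty (H : DiskBranch f g B) : (sphere (0 : ℂ) 1 \ B).Nonempty :=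
  closure_nonempty_iff.1 ⟨1, H.mem_closure_sphere_diff (by simp)⟩

theorem valueCurve_nonempty (H : DiskBranch f g B) : (valueCurve g B).Nonempty :=
  (H.sphere_diff_nonempty.image _).closure

theorem valueCurve_subset_closedBall (H : DiskBranch f g B) : valueCurve g B ⊆ closedBall 0 1 := by
  refine closure_minimal ?_ isClosed_closedBall
  rintro _ ⟨ω, hω, rfl⟩
  exact ball_subset_closedBall (H.diskExtend_mem (sphere_subset_closedBall hω.1) hω.2)

theorem exists_isMinOn (H : DiskBranch f g B) :
    ∃ z ∈ valueCurve g B, IsMinOn (fun z => ‖z‖) (valueCurve g B) z :=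
  ((isCompact_closedBall (0 : ℂ) 1).of_isClosed_subset isClosed_closure
    H.valueCurve_subset_closedBall).exists_isMinOn H.valueCurve_nonempty continuous_norm.continuousOn

theorem norm_lt_one_of_isMinOn (H : DiskBranch f g B) {z : ℂ}
    (h : IsMinOn (fun z => ‖z‖) (valueCurve g B) z) : ‖z‖ < 1 := by
  obtain ⟨ω, hω⟩ := H.sphere_diff_nonempty
  exact (h (subset_closure (mem_image_of_mem _ hω))).trans_lt
    (mem_ball_zero_iff.1 (H.diskExtend_mem (sphere_subset_closedBall hω.1) hω.2))

/-- The small disk is connected and meets the open image at 0. A point of the disk in the closure of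
the image but not in the image would be a boundary value, hence a point of the curve closer to 0
than the minimum. -/
theorem ball_subset_image_of_isMinOn (H : DiskBranch f g B) {z : ℂ}
    (h : IsMinOn (fun z => ‖z‖) (valueCurve g B) z) : ball 0 ‖z‖ ⊆ g '' ball 0 1 := by
  rcases eq_or_ne z 0 with rfl | hz
  · simp
  have hpos : 0 < ‖z‖ := norm_pos_iff.2 hz
  refine (convex_ball (0 : ℂ) ‖z‖).isPreconnected.subset_left_of_subset_union H.isOpen_image
    (isClosed_closure (s := g '' ball 0 1)).isOpen_compl ?_ ?_ ?_
  · exact disjoint_compl_right.mono_left subset_closure |>.symm.symm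
  · intro w hw
    by_contra hcon
    simp only [mem_union, mem_compl_iff, not_or, not_not] at hcon
    rw [mem_ball_zero_iff] at hw
    have hw1 := hw.trans (H.norm_lt_one_of_isMinOn h)
    rw [← H.image_diskExtend] at hcon
    obtain ⟨a, ⟨ha, haB⟩, rfl⟩ := H.exists_of_mem_closure_image H.ball_subset hcon.2 hw1
    rw [closure_ball _ one_ne_zero] at ha
    have has : a ∈ sphere (0 : ℂ) 1 := by
      by_contra hs
      exact hcon.1 (mem_image_of_mem _ (mem_ball.2 (lt_of_le_of_ne (mem_closedBall.1 ha) hs)))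
    exact absurd (h (subset_closure (mem_image_of_mem _ ⟨has, haB⟩))) (not_le.2 hw)
  · exact ⟨0, mem_ball_self hpos, 0, by simp, H.map_zero⟩

theorem ne_zero_of_mem_valueCurve (H : DiskBranch f g B) {z : ℂ} (hz : z ∈ valueCurve g B) :
    z ≠ 0 := by
  rintro rfl
  have := H.valueCurve_subset_frontier hz
  rw [H.isOpen_image.frontier_eq] at this
  exact this.2 ⟨0, by simp, H.map_zero⟩

end DiskBranch

end NoiseSeries

namespace NoiseSeries

/-! ### Analyticity of the boundary curve -/

open ComplexConjugate

theorem analyticAt_conj_comp_inv_conj {E : ℂ → ℂ} {w : ℂ} (hw : w ≠ 0)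
    (hE : AnalyticAt ℂ E (conj w)⁻¹) : AnalyticAt ℂ (fun v => conj (E (conj v)⁻¹)) w := by
  rw [Complex.analyticAt_iff_eventually_differentiableAt] at hE ⊢
  have hc : ContinuousAt (fun v : ℂ => (conj v)⁻¹) w :=
    (Complex.continuous_conj.continuousAt).inv₀ (by simpa using hw)
  filter_upwards [hc.eventually hE, isOpen_ne.mem_nhds hw] with v hv hv0
  have hv' : DifferentiableAt ℂ E (conj v⁻¹) := by rwa [map_inv₀]
  have h1 : DifferentiableAt ℂ (conj ∘ E ∘ conj) v⁻¹ := by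
    have := hv'.conj_conj
    rwa [Complex.conj_conj] at this
  have h2 := h1.comp v (differentiableAt_inv hv0)
  refine h2.congr_of_eventuallyEq (Eventually.of_forall fun u => ?_)
  simp

/-- The Schwarz reflection principle on the unit circle, for a function that is continuous at
the point `ω` and analytic up to the circle at the other points. -/
theorem exists_analyticAt_of_reflection {A : ℂ → ℂ} {ω : ℂ} (hω : ‖ω‖ = 1)
    (hcont : ContinuousWithinAt A (closedBall 0 1) ω)
    (hana : ∀ᶠ w in 𝓝[≠] ω, ‖w‖ ≤ 1 →
      ∃ E, AnalyticAt ℂ E w ∧ A =ᶠ[𝓝[closedBall 0 1] w] E)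
    (hreal : ∀ᶠ w in 𝓝 ω, ‖w‖ = 1 → (A w).im = 0) :
    ∃ F, AnalyticAt ℂ F ω ∧ A =ᶠ[𝓝[closedBall 0 1] ω] F := by
  classical
  have hσfix : ∀ w : ℂ, ‖w‖ = 1 → (conj w)⁻¹ = w := fun w hw => by
    rw [Complex.inv_def, Complex.normSq_eq_norm_sq, Complex.norm_conj, hw]; simp
  have hσc : ∀ w : ℂ, w ≠ 0 → ContinuousAt (fun v : ℂ => (conj v)⁻¹) w := fun w hw =>
    (Complex.continuous_conj.continuousAt).inv₀ (by simpa using hw)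
  have hσn : ∀ w : ℂ, ‖(conj w)⁻¹‖ = ‖w‖⁻¹ := fun w => by simp
  have hω0 : ω ≠ 0 := norm_pos_iff.1 (by rw [hω]; exact one_pos)
  have hσω : Tendsto (fun v : ℂ => (conj v)⁻¹) (𝓝[≠] ω) (𝓝[≠] ω) := by
    refine tendsto_nhdsWithin_iff.2 ⟨?_, ?_⟩
    · have := (hσc ω hω0).tendsto
      rw [hσfix ω hω] at this
      exact this.mono_left nhdsWithin_le_nhds
    · filter_upwards [self_mem_nhdsWithin] with v hv h
      have h' : (conj v)⁻¹ = ω := h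
      rw [← hσfix ω hω, inv_inj] at h'
      exact hv ((starRingEnd ℂ).injective h')
  set F : ℂ → ℂ := fun w => if ‖w‖ ≤ 1 then A w else conj (A (conj w)⁻¹) with hF
  have hAF : A =ᶠ[𝓝[closedBall 0 1] ω] F := by
    filter_upwards [self_mem_nhdsWithin] with w hw
    rw [mem_closedBall_zero_iff] at hw
    simp [hF, hw]
  have hFω : F ω = A ω := by simp [hF, hω]
  have hAω : conj (A ω) = A ω := Complex.conj_eq_iff_im.2 (hreal.self_of_nhds hω)
  -- `F` is `A` inside the circle and its reflection outside. At `ω` only continuity is known, and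
  -- the removable singularity theorem does the rest.
  refine ⟨F, Complex.analyticAt_of_differentiable_on_punctured_nhds_of_continuousAt ?_ ?_, hAF⟩
  · have hreal' : ∀ᶠ w in 𝓝[≠] ω, ∀ᶠ v in 𝓝 w, ‖v‖ = 1 → (A v).im = 0 :=
      nhdsWithin_le_nhds (eventually_eventually_nhds.2 hreal)
    filter_upwards [hana, hσω.eventually hana, hreal',
      nhdsWithin_le_nhds (isOpen_ne.mem_nhds hω0)] with w h₁ h₂ h₃ hw0
    rcases lt_trichotomy ‖w‖ 1 with hw | hw | hw
    · obtain ⟨E, hE, hAE⟩ := h₁ hw.le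
      have hwb : ball (0 : ℂ) 1 ∈ 𝓝 w := isOpen_ball.mem_nhds (mem_ball_zero_iff.2 hw)
      rw [nhdsWithin_eq_nhds.2 (mem_of_superset hwb ball_subset_closedBall)] at hAE
      refine hE.differentiableAt.congr_of_eventuallyEq ?_
      filter_upwards [hAE, hwb] with v hv hvb
      rw [mem_ball_zero_iff] at hvb
      simp [hF, hvb.le, hv]
    · obtain ⟨E, hE, hAE⟩ := h₁ hw.le
      rw [EventuallyEq, eventually_nhdsWithin_iff] at hAE
      have hEσ : AnalyticAt ℂ (fun v => conj (E (conj v)⁻¹)) w :=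
        analyticAt_conj_comp_inv_conj hw0 (by rwa [hσfix w hw])
      -- The local extension and its reflection agree at points of the circle, where `A` is real.
      -- These points accumulate at `w`, so the two agree near `w`.
      have hEE : E =ᶠ[𝓝 w] fun v => conj (E (conj v)⁻¹) := by
        refine (hE.frequently_eq_iff_eventually_eq hEσ).1 ?_
        refine ((frequently_mem_unitSphere (mem_sphere_zero_iff_norm.2 hw)).and_eventually
          (nhdsWithin_le_nhds (hAE.and h₃))).mono ?_
        rintro v ⟨hv, hv1, hv2⟩
        rw [mem_sphere_zero_iff_norm] at hv
        rw [hσfix v hv, ← hv1 (mem_closedBall_zero_iff.2 hv.le)]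
        exact (Complex.conj_eq_iff_im.2 (hv2 hv)).symm
      refine hE.differentiableAt.congr_of_eventuallyEq ?_
      have hσw : Tendsto (fun v : ℂ => (conj v)⁻¹) (𝓝 w) (𝓝 w) := by
        have := (hσc w hw0).tendsto
        rwa [hσfix w hw] at this
      filter_upwards [hAE, hσw.eventually hAE, hEE] with v hv hv' hv''
      by_cases hvn : ‖v‖ ≤ 1
      · simp only [hF, hvn, if_true]
        exact hv (mem_closedBall_zero_iff.2 hvn)
      · simp only [hF, hvn, if_false]
        rw [hv'', hv']
        rw [mem_closedBall_zero_iff, hσn]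
        exact inv_le_one_of_one_le₀ (not_le.1 hvn).le
    · have hσw : ‖(conj w)⁻¹‖ < 1 := by rw [hσn]; exact inv_lt_one_of_one_lt₀ hw
      obtain ⟨E, hE, hAE⟩ := h₂ hσw.le
      have hwb : ball (0 : ℂ) 1 ∈ 𝓝 (conj w)⁻¹ := isOpen_ball.mem_nhds (mem_ball_zero_iff.2 hσw)
      rw [nhdsWithin_eq_nhds.2 (mem_of_superset hwb ball_subset_closedBall)] at hAE
      refine (analyticAt_conj_comp_inv_conj hw0 hE).differentiableAt.congr_of_eventuallyEq ?_
      filter_upwards [(hσc w hw0).eventually hAE,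
        (isOpen_lt continuous_const continuous_norm).mem_nhds hw] with v hv hvb
      have : ¬ ‖v‖ ≤ 1 := not_le.2 hvb
      simp [hF, this, hv]
  · rw [ContinuousAt, hFω]
    refine Tendsto.if ?_ ?_
    · have : {w : ℂ | ‖w‖ ≤ 1} = closedBall 0 1 := by ext; simp
      have h := hcont.tendsto
      rwa [nhdsWithin, ← this] at h
    · rw [← hAω]
      refine (Complex.continuous_conj.tendsto _).comp (hcont.tendsto.comp ?_)
      refine tendsto_nhdsWithin_iff.2 ⟨?_, ?_⟩
      · have := (hσc ω hω0).tendsto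
        rw [hσfix ω hω] at this
        exact this.mono_left inf_le_left
      · filter_upwards [mem_inf_of_right (mem_principal_self _)] with v hv
        rw [mem_closedBall_zero_iff, hσn]
        exact inv_le_one_of_one_le₀ (not_le.1 hv).le

namespace DiskBranch

variable {f g : ℂ → ℂ} {B : Set ℂ}

/-- Points of the curve inside the disk are boundary values, at which `f` returns a point of the
circle. Conversely, a nearby point is recovered from its `f`-value by the chart, whose domain avoids
`B`. -/
theorem eventually_mem_valueCurve_iff (H : DiskBranch f g B) {ω : ℂ}
    (hω : ω ∈ sphere (0 : ℂ) 1) (hB : ω ∉ B) :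
    ∀ᶠ z in 𝓝 (diskExtend g ω), z ∈ valueCurve g B ↔ ‖f z‖ = 1 := by
  have hω' := sphere_subset_closedBall hω
  obtain ⟨h, r, hr, hd, hm, hR, hL, hE, hsub⟩ := H.exists_chart hω' hB
  rw [← hE ⟨mem_ball_self hr, hω'⟩] at hL
  have hmem := H.diskExtend_mem hω' hB
  have hfc : ContinuousAt f (diskExtend g ω) := (H.analyticAt hmem).continuousAt
  have hfr : ∀ᶠ z in 𝓝 (diskExtend g ω), f z ∈ ball ω r :=
    hfc.eventually_mem (by rw [H.apply_diskExtend hω' hB]; exact ball_mem_nhds ω hr)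
  filter_upwards [hL, isOpen_ball.mem_nhds hmem, hfr] with z hz hzb hzr
  constructor
  · intro hzc
    have : z ∈ valueCurve g B ∩ ball 0 1 := ⟨hzc, hzb⟩
    rw [H.valueCurve_inter_ball] at this
    obtain ⟨ω', hω', rfl⟩ := this
    rw [H.apply_diskExtend (sphere_subset_closedBall hω'.1) hω'.2]
    exact mem_sphere_zero_iff_norm.1 hω'.1
  · intro hn
    have hs : f z ∈ sphere (0 : ℂ) 1 := mem_sphere_zero_iff_norm.2 hn
    refine subset_closure ⟨f z, ⟨hs, hsub hzr⟩, ?_⟩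
    rw [hE ⟨hzr, sphere_subset_closedBall hs⟩, hz]

theorem isAnalyticArcAt (H : DiskBranch f g B) {ω : ℂ}
    (hω : ω ∈ sphere (0 : ℂ) 1) (hB : ω ∉ B) :
    IsAnalyticArcAt (valueCurve g B) (diskExtend g ω) := by
  have hω' := sphere_subset_closedBall hω
  have hmem := H.diskExtend_mem hω' hB
  have hfω := H.apply_diskExtend hω' hB
  have hfa := H.analyticAt hmem
  have hn : ‖ω‖ = 1 := mem_sphere_zero_iff_norm.1 hω
  have hω0 : ω ≠ 0 := norm_pos_iff.1 (by rw [hn]; exact one_pos)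
  have hsum : f (diskExtend g ω) + ω ≠ 0 := by rw [hfω]; simpa [← two_mul] using hω0
  -- A Cayley transform sending the unit circle to the real line and `ω` to 0. The imaginary part is
  -- (1 - |f|²) / |f + ω|².
  refine ⟨fun z => -Complex.I * ((f z - ω) / (f z + ω)), ?_, ?_, ?_, ?_⟩
  · exact analyticAt_const.mul ((hfa.sub analyticAt_const).div (hfa.add analyticAt_const) hsum)
  · have hd := hfa.differentiableAt.hasDerivAt
    have := ((hd.sub_const ω).div (hd.add_const ω) hsum).const_mul (-Complex.I)
    refine this.deriv.symm ▸ ?_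
    have hne := H.deriv_ne_zero _ hmem
    rw [hfω] at hsum ⊢
    refine mul_ne_zero (by simp) (div_ne_zero ?_ (pow_ne_zero _ hsum))
    rw [sub_self, zero_mul, sub_zero]
    exact mul_ne_zero hne hsum
  · simp [hfω]
  · have hne : ∀ᶠ z in 𝓝 (diskExtend g ω), f z + ω ≠ 0 :=
      (hfa.continuousAt.add continuousAt_const).eventually_ne hsum
    filter_upwards [H.eventually_mem_valueCurve_iff hω hB, hne] with z hz hz0
    rw [hz]
    have hns : Complex.normSq (f z + ω) ≠ 0 := by simpa using hz0
    have h1 : Complex.normSq ω = 1 := by rw [Complex.normSq_eq_norm_sq, hn]; norm_num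
    have key : (-Complex.I * ((f z - ω) / (f z + ω))).im =
        (1 - Complex.normSq (f z)) / Complex.normSq (f z + ω) := by
      rw [← h1, Complex.mul_im, Complex.div_re]
      simp [Complex.normSq_apply]
      ring
    rw [key, div_eq_zero_iff, or_iff_left hns, Complex.normSq_eq_norm_sq]
    constructor
    · intro h; rw [h]; norm_num
    · intro h
      exact (pow_eq_one_iff_of_nonneg (norm_nonneg _) two_ne_zero).1 (by linarith)

theorem analyticAt_curve (H : DiskBranch f g B) {θ : ℝ}
    (hB : Complex.exp (θ * Complex.I) ∉ B) :
    AnalyticAt ℝ (fun t : ℝ => diskExtend g (Complex.exp (t * Complex.I))) θ ∧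
      deriv (fun t : ℝ => diskExtend g (Complex.exp (t * Complex.I))) θ ≠ 0 := by
  set e : ℝ → ℂ := fun t => Complex.exp (t * Complex.I) with he
  have hes : ∀ t, e t ∈ closedBall (0 : ℂ) 1 := fun t =>
    mem_closedBall_zero_iff.2 (Complex.norm_exp_ofReal_mul_I t).le
  have hea : AnalyticAt ℝ e θ := by
    have h1 : AnalyticAt ℂ (fun z : ℂ => Complex.exp (z * Complex.I)) (Complex.ofRealCLM θ) := by
      fun_prop
    exact (h1.restrictScalars (𝕜 := ℝ)).comp (Complex.ofRealCLM.analyticAt θ)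
  obtain ⟨h, r, hr, hd, hm, hR, hL, hE, hsub⟩ := H.exists_chart (hes θ) hB
  have hEe : (fun t => h (e t)) =ᶠ[𝓝 θ] fun t => diskExtend g (e t) := by
    filter_upwards [hea.continuousAt.eventually_mem (ball_mem_nhds _ hr)] with t ht
    exact (hE ⟨ht, hes t⟩).symm
  have hha : AnalyticAt ℂ h (e θ) := hd.analyticAt (ball_mem_nhds _ hr)
  have hA : AnalyticAt ℝ (fun t => diskExtend g (e t)) θ :=
    ((hha.restrictScalars (𝕜 := ℝ)).comp hea).congr hEe
  refine ⟨hA, fun h0 => ?_⟩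
  -- Composing the curve with `f` returns `e`, whose derivative does not vanish.
  have h1 : HasDerivAt (fun t => diskExtend g (e t)) 0 θ := h0 ▸ hA.differentiableAt.hasDerivAt
  have hfd := (H.analyticAt (H.diskExtend_mem (hes θ) hB)).differentiableAt.hasDerivAt
  have h2 : HasDerivAt (f ∘ fun t => diskExtend g (e t)) _ θ := HasDerivAt.scomp θ hfd h1
  rw [zero_smul] at h2
  have h3 : HasDerivAt e (e θ * Complex.I) θ := by
    have : HasDerivAt (fun z : ℂ => Complex.exp (z * Complex.I))
        (Complex.exp (θ * Complex.I) * Complex.I) (θ : ℂ) := by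
      simpa using ((hasDerivAt_id (θ : ℂ)).mul_const Complex.I).cexp
    exact this.comp_ofReal
  have h4 : e =ᶠ[𝓝 θ] (f ∘ fun t => diskExtend g (e t)) := by
    filter_upwards [hea.continuousAt.eventually_mem (ball_mem_nhds _ hr)] with t ht
    exact (H.apply_diskExtend (hes t) (hsub ht)).symm
  have := h3.unique (h2.congr_of_eventuallyEq h4)
  simp [he] at this

/-- The map straightening the arc makes the extended branch real on the circle near `ω`. Reflection
continues the composite across `ω`, and the local inverse of the straightening map is then applied.
-/
theorem isRegularPoint_of_isAnalyticArcAt (H : DiskBranch f g B) {ω ζ : ℂ} (hω : ω ∈ B)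
    (hlim : Tendsto g (𝓝[ball 0 1] ω) (𝓝 ζ)) (harc : IsAnalyticArcAt (valueCurve g B) ζ) :
    IsRegularPoint (diskExtend g) (ball 0 1) ω := by
  obtain ⟨h, hh, hh', hhζ, hcur⟩ := harc
  have hωs := H.subset_sphere hω
  have hω' := sphere_subset_closedBall hωs
  have hGω : diskExtend g ω = ζ := extendFrom_eq (mem_closure_unitBall hω') hlim
  have hG : ContinuousWithinAt (diskExtend g) (closedBall 0 1) ω := by
    have h1 : ContinuousWithinAt (diskExtend g) (closedBall 0 1 \ B) ω := by
      have := H.tendsto_diskExtend hlim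
      rwa [← hGω] at this
    refine (continuousWithinAt_insert_self.2 h1).mono_of_mem_nhdsWithin ?_
    have h2 := H.eventually_notMem ω
    rw [eventually_nhdsWithin_iff] at h2
    filter_upwards [self_mem_nhdsWithin, mem_nhdsWithin_of_mem_nhds h2] with w hw hw'
    by_cases hww : w = ω
    · exact Or.inl hww
    · exact Or.inr ⟨hw, hw' hww⟩
  have hev : ∀ᶠ w in 𝓝 ω, ‖w‖ ≤ 1 → AnalyticAt ℂ h (diskExtend g w) ∧
      (diskExtend g w ∈ valueCurve g B ↔ (h (diskExtend g w)).im = 0) := by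
    have := hG.tendsto
    rw [hGω] at this
    have := this.eventually (hh.eventually_analyticAt.and hcur)
    rw [eventually_nhdsWithin_iff] at this
    simpa only [mem_closedBall_zero_iff] using this
  obtain ⟨F, hF, hAF⟩ : ∃ F, AnalyticAt ℂ F ω ∧
      (fun w => h (diskExtend g w)) =ᶠ[𝓝[closedBall 0 1] ω] F := by
    refine exists_analyticAt_of_reflection (mem_sphere_zero_iff_norm.1 hωs) ?_ ?_ ?_
    · refine ContinuousAt.comp_continuousWithinAt (g := h) ?_ hG
      rw [hGω]
      exact hh.continuousAt
    · filter_upwards [H.eventually_notMem ω, nhdsWithin_le_nhds hev] with w hwB hw hw1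
      have hw' := mem_closedBall_zero_iff.2 hw1
      obtain ⟨k, r, hr, hd, -, -, -, hE, -⟩ := H.exists_chart hw' hwB
      have hkw := hE ⟨mem_ball_self hr, hw'⟩
      refine ⟨fun v => h (k v), AnalyticAt.fun_comp ?_ (hd.analyticAt (ball_mem_nhds w hr)), ?_⟩
      · rw [← hkw]; exact (hw hw1).1
      · filter_upwards [self_mem_nhdsWithin, mem_nhdsWithin_of_mem_nhds (ball_mem_nhds w hr)]
          with v h₁ h₂
        rw [hE ⟨h₂, h₁⟩]
    · have h2 := H.eventually_notMem ω
      rw [eventually_nhdsWithin_iff] at h2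
      filter_upwards [hev, h2] with w hw hwB hw1
      by_cases hww : w = ω
      · rw [hww, hGω, hhζ]
      · exact (hw hw1.le).2.1 (subset_closure
          (mem_image_of_mem _ ⟨mem_sphere_zero_iff_norm.2 hw1, hwB hww⟩))
  have hFω : F ω = h ζ := by
    rw [← hGω]
    exact (hAF.self_of_nhdsWithin hω').symm
  refine ⟨fun w => hh.hasStrictDerivAt.localInverse _ _ _ hh' (F w), ?_, ?_⟩
  · refine AnalyticAt.fun_comp ?_ hF
    rw [hFω]
    exact hh.analyticAt_localInverse hh'
  · have hL : ∀ᶠ z in 𝓝 ζ, hh.hasStrictDerivAt.localInverse _ _ _ hh' (h z) = z :=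
      HasStrictDerivAt.eventually_left_inverse ..
    have := hG.tendsto
    rw [hGω] at this
    filter_upwards [nhdsWithin_mono ω ball_subset_closedBall hAF,
      nhdsWithin_mono ω ball_subset_closedBall (this.eventually hL)] with w hw hw'
    rw [← hw, hw']

end DiskBranch

end NoiseSeries

namespace NoiseSeries

/-! ### Noise series -/

open FormalMultilinearSeries

theorem hasSum_noise (ε : ℝ) {a : ℕ → ℝ} {M : ℝ} (ha : ∀ k, |a k| ≤ M) {w : ℂ}
    (hw : w ∈ ball (0 : ℂ) 1) : HasSum (fun k => (ε : ℂ) * (a k : ℂ) * w ^ k) (noise ε a w) := by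
  rw [mem_ball_zero_iff] at hw
  refine Summable.hasSum (Summable.of_norm_bounded
    (g := fun k => |ε| * M * ‖w‖ ^ k)
    ((summable_geometric_of_lt_one (norm_nonneg w) hw).mul_left _) fun k => ?_)
  rw [norm_mul, norm_mul, norm_pow, Complex.norm_real, Complex.norm_real, Real.norm_eq_abs,
    Real.norm_eq_abs]
  gcongr
  exact ha k

theorem hasFPowerSeriesOnBall_noise (ε : ℝ) {a : ℕ → ℝ} {M : ℝ} (ha : ∀ k, |a k| ≤ M) :
    HasFPowerSeriesOnBall (noise ε a) (ofScalars ℂ fun k => (ε : ℂ) * (a k : ℂ)) 0 1 where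
  r_le := by
    have : ((1 : NNReal) : ENNReal) ≤ (ofScalars ℂ fun k => (ε : ℂ) * (a k : ℂ)).radius := by
      refine le_radius_of_bound _ (|ε| * M) fun n => ?_
      rw [ofScalars_norm, norm_mul, Complex.norm_real, Complex.norm_real, Real.norm_eq_abs,
        Real.norm_eq_abs, NNReal.coe_one, one_pow, mul_one]
      gcongr
      exact ha n
    simpa using this
  r_pos := one_pos
  hasSum := by
    intro y hy
    have hy' : y ∈ ball (0 : ℂ) 1 := by simpa [← Metric.eball_ofReal] using hy
    rw [zero_add]
    simpa only [ofScalars_apply_eq, smul_eq_mul] using hasSum_noise ε ha hy'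

theorem differentiableOn_noise (ε : ℝ) {a : ℕ → ℝ} {M : ℝ} (ha : ∀ k, |a k| ≤ M) :
    DifferentiableOn ℂ (noise ε a) (ball 0 1) := by
  have := (hasFPowerSeriesOnBall_noise ε ha).differentiableOn
  rwa [← ENNReal.ofReal_one, Metric.eball_ofReal] at this

theorem noise_sub (ε : ℝ) {a b : ℕ → ℝ} {M N : ℝ} (ha : ∀ k, |a k| ≤ M) (hb : ∀ k, |b k| ≤ N)
    {w : ℂ} (hw : w ∈ ball (0 : ℂ) 1) :
    noise ε (fun k => a k - b k) w = noise ε a w - noise ε b w := by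
  refine HasSum.tsum_eq ?_
  refine ((hasSum_noise ε ha hw).sub (hasSum_noise ε hb hw)).congr_fun ?_
  intro k
  push_cast
  ring

/-- Cauchy estimates for the derivative on circles of radius R, as R → 1. -/
theorem mul_norm_coeff_le_of_norm_deriv_le {F : ℂ → ℂ} {c : ℕ → ℂ} {M : ℝ}
    (hF : HasFPowerSeriesAt F (ofScalars ℂ c) 0) (hd : DifferentiableOn ℂ F (ball 0 1))
    (hM : ∀ w ∈ ball (0 : ℂ) 1, ‖deriv F w‖ ≤ M) (k : ℕ) : (k + 1) * ‖c (k + 1)‖ ≤ M := by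
  have hc : c (k + 1) = iteratedDeriv (k + 1) F 0 / ((k + 1).factorial : ℂ) := by
    have := hF.eq_formalMultilinearSeries hF.analyticAt.hasFPowerSeriesAt
    have := congrArg (fun p => p.coeff (k + 1)) this
    simpa only [coeff_ofScalars] using this
  have hd' : DifferentiableOn ℂ (deriv F) (ball 0 1) := hd.deriv isOpen_ball
  have key : ∀ R : ℝ, 0 < R → R < 1 → ‖iteratedDeriv (k + 1) F 0‖ * R ^ k ≤ k.factorial * M := by
    intro R hR hR1
    rw [iteratedDeriv_succ', ← le_div_iff₀ (pow_pos hR k)]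
    refine Complex.norm_iteratedDeriv_le_of_forall_mem_sphere_norm_le k hR ?_ fun z hz => ?_
    · refine (hd'.mono ?_).diffContOnCl
      exact (closure_ball_subset_closedBall).trans (closedBall_subset_ball hR1)
    · refine hM z (mem_ball_zero_iff.2 ?_)
      rwa [mem_sphere_zero_iff_norm.1 hz]
  have hlim : ‖iteratedDeriv (k + 1) F 0‖ ≤ k.factorial * M := by
    have ht : Tendsto (fun R : ℝ => ‖iteratedDeriv (k + 1) F 0‖ * R ^ k) (𝓝[<] 1)
        (𝓝 (‖iteratedDeriv (k + 1) F 0‖ * 1 ^ k)) :=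
      ((continuous_const.mul (continuous_id.pow k)).tendsto 1).mono_left nhdsWithin_le_nhds
    rw [one_pow, mul_one] at ht
    refine le_of_tendsto ht ?_
    filter_upwards [Ioo_mem_nhdsLT (zero_lt_one' ℝ)] with R hR using key R hR.1 hR.2
  rw [hc, norm_div, Complex.norm_natCast, Nat.factorial_succ]
  push_cast
  have h1 : (0 : ℝ) < k.factorial := by exact_mod_cast k.factorial_pos
  rw [mul_div_assoc', mul_div_mul_left _ _ (by positivity), div_le_iff₀ h1, mul_comm M]
  exact hlim

/-- The n-th roots of unity are spaced 2π/n in argument, so rounding the argument of `ζ / u` down to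
a multiple of 2π/n suffices. -/
theorem exists_norm_rotation_sub_lt {n : ℕ} {δ : ℝ} (hn : 2 * Real.pi / n < δ) (hn0 : 0 < n)
    {u ζ : ℂ} (hu : ‖u‖ = 1) (hζ : ‖ζ‖ = 1) :
    ∃ η : ℂ, η ^ n = 1 ∧ ‖η * u - ζ‖ < δ := by
  have hpi := Real.pi_pos
  have hu0 : u ≠ 0 := norm_pos_iff.1 (by rw [hu]; exact one_pos)
  have hn0' : (0 : ℝ) < n := by exact_mod_cast hn0
  set θ := Complex.arg (ζ / u) with hθ
  have hζu : Complex.exp (Complex.I * θ) = ζ / u := by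
    have := Complex.norm_mul_exp_arg_mul_I (ζ / u)
    rw [norm_div, hu, hζ, div_one, Complex.ofReal_one, one_mul] at this
    rw [mul_comm, this]
  set j : ℤ := ⌊θ / (2 * Real.pi / n)⌋ with hj
  set s : ℝ := j * (2 * Real.pi / n) with hs
  have hpos : 0 < 2 * Real.pi / n := by positivity
  have h1 : s ≤ θ := by
    have := Int.floor_le (θ / (2 * Real.pi / n))
    rwa [le_div_iff₀ hpos] at this
  have h2 : θ < s + 2 * Real.pi / n := by
    have := Int.lt_floor_add_one (θ / (2 * Real.pi / n))
    rw [div_lt_iff₀ hpos, ← hj] at this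
    rw [hs]
    linarith
  refine ⟨Complex.exp (Complex.I * s), ?_, ?_⟩
  · rw [← Complex.exp_nat_mul, Complex.exp_eq_one_iff]
    refine ⟨j, ?_⟩
    have hnc : (n : ℂ) ≠ 0 := by exact_mod_cast hn0.ne'
    rw [hs]
    push_cast
    field_simp
  · have h3 : Complex.exp (Complex.I * s) * u - ζ =
        -(Complex.exp (Complex.I * s) * u * (Complex.exp (Complex.I * (θ - s : ℝ)) - 1)) := by
      have : Complex.exp (Complex.I * s) * Complex.exp (Complex.I * (θ - s : ℝ)) = ζ / u := by
        rw [← hζu, ← Complex.exp_add]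
        congr 1
        push_cast
        ring
      have h4 : ζ = u * (Complex.exp (Complex.I * s) * Complex.exp (Complex.I * (θ - s : ℝ))) := by
        rw [this, mul_div_cancel₀ _ hu0]
      rw [h4]
      ring
    rw [h3, norm_neg, norm_mul, norm_mul, hu, mul_comm Complex.I (s : ℂ),
      Complex.norm_exp_ofReal_mul_I, one_mul, one_mul]
    refine (Real.norm_exp_I_mul_ofReal_sub_one_le).trans_lt ?_
    rw [Real.norm_eq_abs, abs_of_nonneg (by linarith)]
    linarith

/-- A power series with bounded real coefficients in powers of `w ^ n` which is Lipschitz near a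
point of the unit circle has coefficients tending to zero, if `n` is large. -/
theorem tendsto_coeff_zero_of_lipschitz {ε : ℝ} (hε : 0 < ε) {d : ℕ → ℝ} {M : ℝ}
    (hd : ∀ k, |d k| ≤ M) {n : ℕ} (hsupp : ∀ k, ¬ n ∣ k → d k = 0) {ζ : ℂ} (hζ : ‖ζ‖ = 1)
    {δ : ℝ} (hδ : 0 < δ) (hn0 : 0 < n) (hn : 2 * Real.pi / n < δ / 2) {C : ℝ}
    (hlip : ∀ w ∈ ball (0 : ℂ) 1 ∩ ball ζ δ, ∀ v ∈ ball (0 : ℂ) 1 ∩ ball ζ δ,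
      ‖noise ε d w - noise ε d v‖ ≤ C * ‖w - v‖) : Tendsto d atTop (𝓝 0) := by
  have hF := differentiableOn_noise ε hd
  set F := noise ε d with hFdef
  -- The series contains only powers of `w ^ n`, so `F` is invariant under n-th roots of unity.
  have hrot : ∀ η : ℂ, η ^ n = 1 → ∀ w ∈ ball (0 : ℂ) 1, ‖deriv F (η * w)‖ = ‖deriv F w‖ := by
    intro η hη w hw
    have hFη : (fun w => F (η * w)) = F := by
      funext w
      refine tsum_congr fun k => ?_
      by_cases hk : n ∣ k
      · obtain ⟨m, rfl⟩ := hk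
        rw [mul_pow, pow_mul η, hη, one_pow, one_mul]
      · simp [hsupp k hk]
    have h1 : deriv (fun w => F (η * w)) w = η * deriv F (η * w) := by
      have := deriv_comp_mul_left η F w
      simpa using this
    rw [hFη] at h1
    have hη1 : ‖η‖ = 1 := Complex.norm_eq_one_of_pow_eq_one hη hn0.ne'
    rw [h1, norm_mul, hη1, one_mul]
  have hnear : ∀ w ∈ ball (0 : ℂ) 1 ∩ ball ζ δ, ‖deriv F w‖ ≤ |C| := by
    intro w hw
    refine norm_deriv_le_of_lip' (abs_nonneg C) ?_
    filter_upwards [(isOpen_ball.inter isOpen_ball).mem_nhds hw] with v hv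
    exact (hlip v hv w hw).trans (by gcongr; exact le_abs_self C)
  have hdF : ContinuousOn (deriv F) (ball 0 1) := (hF.deriv isOpen_ball).continuousOn
  obtain ⟨K, hK⟩ := (isCompact_closedBall (0 : ℂ) (1 - δ / 2)).exists_bound_of_continuousOn
    (hdF.mono (closedBall_subset_ball (by linarith)))
  -- A point within `δ / 2` of the circle is rotated into the ball about `ζ`: less than `δ / 2` is
  -- lost in angle and less than `δ / 2` in radius.
  have hbound : ∀ w ∈ ball (0 : ℂ) 1, ‖deriv F w‖ ≤ max K |C| := by
    intro w hw
    by_cases hw1 : ‖w‖ ≤ 1 - δ / 2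
    · exact (hK w (mem_closedBall_zero_iff.2 hw1)).trans (le_max_left _ _)
    · push Not at hw1
      have hwn := mem_ball_zero_iff.1 hw
      by_cases hw0 : w = 0
      · subst hw0
        rw [norm_zero] at hw1
        refine (hnear 0 ⟨hw, ?_⟩).trans (le_max_right _ _)
        rw [mem_ball, dist_eq_norm, zero_sub, norm_neg, hζ]
        linarith
      · have hwpos : 0 < ‖w‖ := norm_pos_iff.2 hw0
        have hu : ‖w / ‖w‖‖ = 1 := by
          rw [norm_div, Complex.norm_real, norm_norm, div_self hwpos.ne']
        obtain ⟨η, hη, hηζ⟩ := exists_norm_rotation_sub_lt hn hn0 hu hζ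
        have hη1 : ‖η‖ = 1 := Complex.norm_eq_one_of_pow_eq_one hη hn0.ne'
        rw [← hrot η hη w hw]
        refine (hnear _ ⟨?_, ?_⟩).trans (le_max_right _ _)
        · rw [mem_ball_zero_iff, norm_mul, hη1, one_mul]; exact hwn
        · rw [mem_ball, dist_eq_norm]
          have e1 : η * w - ζ = (η * (w / ‖w‖) - ζ) + η * (w / ‖w‖) * ((‖w‖ : ℂ) - 1) := by
            have : (‖w‖ : ℂ) ≠ 0 := by exact_mod_cast hwpos.ne'
            field_simp
            ring
          have e2 : ‖(‖w‖ : ℂ) - 1‖ = 1 - ‖w‖ := by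
            rw [← Complex.ofReal_one, ← Complex.ofReal_sub, Complex.norm_real, Real.norm_eq_abs,
              abs_sub_comm, abs_of_nonneg (by linarith)]
          rw [e1]
          refine (norm_add_le _ _).trans_lt ?_
          rw [norm_mul (η * (w / ‖w‖)), norm_mul η, hη1, hu, e2]
          linarith
  have hcoeff := mul_norm_coeff_le_of_norm_deriv_le
    (hasFPowerSeriesOnBall_noise ε hd).hasFPowerSeriesAt hF hbound
  rw [← tendsto_add_atTop_iff_nat 1]
  have hlim : Tendsto (fun k : ℕ => max K |C| / ε * (1 / ((k : ℝ) + 1))) atTop (𝓝 0) := by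
    simpa using (tendsto_one_div_add_atTop_nhds_zero_nat (𝕜 := ℝ)).const_mul (max K |C| / ε)
  refine squeeze_zero_norm (fun k => ?_) hlim
  have := hcoeff k
  rw [norm_mul, Complex.norm_real, Complex.norm_real, Real.norm_of_nonneg hε.le] at this
  rw [div_mul_div_comm, mul_one, le_div_iff₀ (by positivity)]
  linarith

end NoiseSeries

namespace NoiseSeries

/-! ### Random noise series -/

/-- The coefficient sequences in `[-1, 1]` whose noise series is Lipschitz in the part of the unit
disk near `ζ`. -/
def lipschitzNoise (ε : ℝ) (ζ : ℂ) (δ C : ℝ) : Set (ℕ → ℝ) :=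
  {a | (∀ k, |a k| ≤ 1) ∧ ∀ w ∈ ball (0 : ℂ) 1 ∩ ball ζ δ, ∀ v ∈ ball (0 : ℂ) 1 ∩ ball ζ δ,
    ‖noise ε a w - noise ε a v‖ ≤ C * ‖w - v‖}

/-- This supplies measurability. For fixed w in the disk the series is continuous in sequences
bounded by 1, by the Weierstrass test. -/
theorem isClosed_lipschitzNoise (ε : ℝ) (ζ : ℂ) (δ C : ℝ) :
    IsClosed (lipschitzNoise ε ζ δ C) := by
  set Q : Set (ℕ → ℝ) := {a | ∀ k, |a k| ≤ 1} with hQ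
  have hQc : IsClosed Q := by
    simp only [hQ, ofPred_forall]
    exact isClosed_iInter fun k => isClosed_le (by fun_prop) continuous_const
  have hcont : ∀ w ∈ ball (0 : ℂ) 1, ContinuousOn (fun a => noise ε a w) Q := by
    intro w hw
    rw [mem_ball_zero_iff] at hw
    refine continuousOn_tsum (u := fun k => |ε| * ‖w‖ ^ k) (fun k => ?_)
      ((summable_geometric_of_lt_one (norm_nonneg w) hw).mul_left _) fun k a ha => ?_
    · exact Continuous.continuousOn (by fun_prop)
    · rw [norm_mul, norm_mul, norm_pow, Complex.norm_real, Complex.norm_real, Real.norm_eq_abs,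
        Real.norm_eq_abs]
      have := mul_le_mul_of_nonneg_left (ha k) (abs_nonneg ε)
      rw [mul_one] at this
      gcongr
  have : lipschitzNoise ε ζ δ C = Q ∩ ⋂ w ∈ ball (0 : ℂ) 1 ∩ ball ζ δ,
      ⋂ v ∈ ball (0 : ℂ) 1 ∩ ball ζ δ,
        (Q ∩ (fun a => ‖noise ε a w - noise ε a v‖) ⁻¹' Iic (C * ‖w - v‖)) := by
    refine Subset.antisymm (fun a ha => ⟨ha.1, mem_iInter₂.2 fun w hw => mem_iInter₂.2 fun v hv =>
      ⟨ha.1, ha.2 w hw v hv⟩⟩) fun a ha => ⟨ha.1, fun w hw v hv =>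
        (mem_iInter₂.1 (mem_iInter₂.1 ha.2 w hw) v hv).2⟩
  rw [this]
  refine hQc.inter (isClosed_biInter fun w hw => isClosed_biInter fun v hv => ?_)
  exact (((hcont w hw.1).sub (hcont v hv.1)).norm).preimage_isClosed_of_isClosed hQc isClosed_Iic

/-- The uniform distribution on `[-1, 1]`. -/
abbrev symmetricUniform : Measure ℝ := ProbabilityTheory.cond volume (Icc (-1 : ℝ) 1)

instance : IsProbabilityMeasure symmetricUniform :=
  cond_isProbabilityMeasure_of_finite (by simp) (by simp)

theorem measurePreserving_neg_symmetricUniform :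
    MeasurePreserving (fun x : ℝ => -x) symmetricUniform symmetricUniform := by
  refine ⟨measurable_neg, ?_⟩
  have h := (Measure.measurePreserving_neg (volume : Measure ℝ)).restrict_preimage
    (s := Icc (-1 : ℝ) 1) measurableSet_Icc
  have hs : Neg.neg ⁻¹' Icc (-1 : ℝ) 1 = Icc (-1) 1 := by
    ext x
    simp only [mem_preimage, mem_Icc]
    constructor <;> rintro ⟨h₁, h₂⟩ <;> constructor <;> linarith
  rw [hs] at h
  rw [symmetricUniform, ProbabilityTheory.cond, Measure.map_smul]
  congr 1
  exact h.map_eq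

/-- The distribution of a sequence of independent random variables, uniform on `[-1, 1]`. -/
abbrev uniformSequence : Measure (ℕ → ℝ) := Measure.infinitePi fun _ => symmetricUniform

/-- Change the signs of the terms of a sequence whose indices lie in `A`. -/
def flipSigns (A : Set ℕ) [DecidablePred (· ∈ A)] (a : ℕ → ℝ) (k : ℕ) : ℝ :=
  if k ∈ A then -a k else a k

theorem measurePreserving_flipSigns (A : Set ℕ) [DecidablePred (· ∈ A)] :
    MeasurePreserving (flipSigns A) uniformSequence uniformSequence := by
  have hm : ∀ k : ℕ, Measurable fun x : ℝ => if k ∈ A then -x else x := fun k => by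
    split_ifs <;> fun_prop
  refine ⟨measurable_pi_iff.2 fun k => (hm k).comp (measurable_pi_apply k), ?_⟩
  have := Measure.infinitePi_map_pi (fun _ : ℕ => symmetricUniform) hm
  refine this.trans ?_
  congr 1
  funext k
  split_ifs
  · exact measurePreserving_neg_symmetricUniform.map_eq
  · exact Measure.map_id

/-- Convergence to 0 eventually confines these coordinates to (-1/2, 1/2), and m distinct
coordinates lie there with probability 2⁻ᵐ. -/
theorem measure_tendsto_zero_eq_zero {κ : ℕ → ℕ} (hκ : Function.Injective κ) :
    uniformSequence {a | Tendsto (fun l => a (κ l)) atTop (𝓝 0)} = 0 := by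
  have hhalf : symmetricUniform (Ioo (-(1 / 2)) (1 / 2)) = 1 / 2 := by
    rw [cond_apply measurableSet_Icc, inter_eq_right.2
      (Ioo_subset_Icc_self.trans (Icc_subset_Icc (by norm_num) (by norm_num))),
      Real.volume_Icc, Real.volume_Ioo]
    norm_num
  have hL : ∀ L : ℕ, uniformSequence {a | ∀ l ≥ L, a (κ l) ∈ Ioo (-(1 / 2) : ℝ) (1 / 2)} = 0 := by
    intro L
    refine le_antisymm (ge_of_tendsto' (ENNReal.tendsto_pow_atTop_nhds_zero_of_lt_one
      (r := 1 / 2) (by simp)) fun m => ?_) zero_le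
    set s : Finset ℕ := (Finset.Ico L (L + m)).image κ with hs
    have hcard : s.card = m := by
      rw [hs, Finset.card_image_of_injective _ hκ, Nat.card_Ico, Nat.add_sub_cancel_left]
    calc uniformSequence {a | ∀ l ≥ L, a (κ l) ∈ Ioo (-(1 / 2) : ℝ) (1 / 2)}
        ≤ uniformSequence (Set.pi s fun _ => Ioo (-(1 / 2) : ℝ) (1 / 2)) := by
          refine measure_mono fun a ha k hk => ?_
          simp only [hs, Finset.coe_image, mem_image, Finset.coe_Ico, mem_Ico] at hk
          obtain ⟨l, hl, rfl⟩ := hk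
          exact ha l hl.1
      _ = (1 / 2) ^ m := by
          rw [Measure.infinitePi_pi _ fun _ _ => measurableSet_Ioo, Finset.prod_const, hhalf,
            hcard]
  refine measure_mono_null (fun a ha => ?_) (measure_iUnion_null hL)
  obtain ⟨L, hL⟩ := eventually_atTop.1
    ((ha : Tendsto _ _ _).eventually_mem (Ioo_mem_nhds (a := (-(1 / 2) : ℝ)) (b := 1 / 2)
      (by norm_num) (by norm_num)))
  exact mem_iUnion.2 ⟨L, hL⟩

/-- The sets `E i`, obtained by sign changes, all have the measure of `V` and are pairwise almost
disjoint. A probability space has no room for infinitely many of them unless that measure is 0. -/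
theorem measure_lipschitzNoise {ε : ℝ} (hε : 0 < ε) {ζ : ℂ} {δ : ℝ} (hδ : 0 < δ) (C : ℝ)
    (hζ : ‖ζ‖ = 1) : uniformSequence (lipschitzNoise ε ζ δ C) = 0 := by
  classical
  obtain ⟨n, hn0, hn⟩ : ∃ n : ℕ, 0 < n ∧ 2 * Real.pi / n < δ / 2 := by
    have h1 : Tendsto (fun n : ℕ => 2 * Real.pi / (n : ℝ)) atTop (𝓝 0) :=
      tendsto_const_div_atTop_nhds_zero_nat _
    exact ((eventually_gt_atTop 0).and (h1.eventually_lt_const (by linarith))).exists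
  set V := lipschitzNoise ε ζ δ C with hV
  have hVm : MeasurableSet V := (isClosed_lipschitzNoise ε ζ δ C).measurableSet
  -- The pairing function splits the multiples of `n` into infinitely many disjoint infinite sets.
  set A : ℕ → Set ℕ := fun i => range fun l => n * Nat.pair i l with hA
  set E : ℕ → Set (ℕ → ℝ) := fun i => flipSigns (A i) ⁻¹' V with hE
  have hEm : ∀ i, uniformSequence (E i) = uniformSequence V := fun i =>
    (measurePreserving_flipSigns (A i)).measure_preimage hVm.nullMeasurableSet
  have hmemA : ∀ i j l, n * Nat.pair i l ∈ A j ↔ i = j := by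
    intro i j l
    constructor
    · rintro ⟨l', hl'⟩
      have := Nat.eq_of_mul_eq_mul_left hn0 hl'
      exact ((Nat.pair_eq_pair.1 this).1).symm
    · rintro rfl
      exact ⟨l, rfl⟩
  have hdisj : Pairwise (Function.onFun (AEDisjoint uniformSequence) E) := by
    intro i j hij
    have hinj : Function.Injective fun l => n * Nat.pair i l := fun l l' h =>
      (Nat.pair_eq_pair.1 (Nat.eq_of_mul_eq_mul_left hn0 h)).2
    refine measure_mono_null (fun a ha => ?_) (measure_tendsto_zero_eq_zero hinj)
    obtain ⟨⟨hi, hi'⟩, ⟨hj, hj'⟩⟩ := ha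
    set d : ℕ → ℝ := fun k => flipSigns (A i) a k - flipSigns (A j) a k with hd
    have hdb : ∀ k, |d k| ≤ 2 := fun k => (abs_sub _ _).trans (by linarith [hi k, hj k])
    have hsupp : ∀ k, ¬ n ∣ k → d k = 0 := by
      intro k hk
      have : ∀ i, k ∉ A i := by
        rintro i ⟨l, rfl⟩
        exact hk (dvd_mul_right _ _)
      simp [hd, flipSigns, this]
    have hlim := tendsto_coeff_zero_of_lipschitz hε hdb hsupp hζ hδ hn0 hn (C := 2 * C) ?_
    -- On `A i` the difference `d` equals `-2 * a`.
    · have h2 := (hlim.comp hinj.nat_tendsto_atTop).const_mul (-(1 / 2))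
      rw [mul_zero] at h2
      refine h2.congr fun l => ?_
      simp only [hd, flipSigns, Function.comp_apply, hmemA, if_true, hij, if_false]
      ring
    · intro w hw v hv
      rw [noise_sub ε hi hj hw.1, noise_sub ε hi hj hv.1]
      have e : noise ε (flipSigns (A i) a) w - noise ε (flipSigns (A j) a) w -
          (noise ε (flipSigns (A i) a) v - noise ε (flipSigns (A j) a) v) =
          (noise ε (flipSigns (A i) a) w - noise ε (flipSigns (A i) a) v) -
          (noise ε (flipSigns (A j) a) w - noise ε (flipSigns (A j) a) v) := by ring
      rw [e]
      refine (norm_sub_le _ _).trans ?_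
      linarith [hi' w hw v hv, hj' w hw v hv]
  have hsum := tsum_measure_le_measure_univ (μ := uniformSequence) (s := E)
    (fun i => ((measurePreserving_flipSigns (A i)).measurable hVm).nullMeasurableSet) hdisj
  simp_rw [hEm, measure_univ] at hsum
  by_contra hne
  rw [ENNReal.tsum_const_eq_top_of_ne_zero hne] at hsum
  exact absurd hsum (by simp)

theorem exists_mem_lipschitzNoise {ε : ℝ} {a : ℕ → ℝ} (ha : ∀ k, |a k| ≤ 1) {ζ : ℂ}
    (hreg : IsRegularPoint (noise ε a) (ball 0 1) ζ) :
    ∃ δ > 0, ∃ C, a ∈ lipschitzNoise ε ζ δ C := by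
  obtain ⟨g, hg, hgeq⟩ := hreg
  obtain ⟨K, s, hs, hK⟩ := hg.hasStrictDerivAt.hasStrictFDerivAt.exists_lipschitzOnWith
  rw [EventuallyEq, eventually_nhdsWithin_iff] at hgeq
  obtain ⟨δ, hδ, hball⟩ := Metric.eventually_nhds_iff_ball.1 (hgeq.and hs)
  refine ⟨δ, hδ, K, ha, fun w hw v hv => ?_⟩
  rw [(hball w hw.2).1 hw.1, (hball v hv.2).1 hv.1]
  exact hK.norm_sub_le (hball w hw.2).2 (hball v hv.2).2

theorem lipschitzNoise_mono {ε : ℝ} {ζ ζ' : ℂ} {δ δ' C C' : ℝ} (hC : C ≤ C')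
    (h : ball ζ' δ' ⊆ ball ζ δ) : lipschitzNoise ε ζ δ C ⊆ lipschitzNoise ε ζ' δ' C' :=
  fun _ ha => ⟨ha.1, fun w hw v hv => (ha.2 w ⟨hw.1, h hw.2⟩ v ⟨hv.1, h hv.2⟩).trans
    (by gcongr)⟩

theorem ae_abs_le_one : ∀ᵐ a ∂uniformSequence, ∀ k, |a k| ≤ 1 := by
  rw [ae_all_iff]
  intro k
  have h1 : ∀ᵐ x ∂symmetricUniform, |x| ≤ 1 := by
    filter_upwards [ae_cond_mem (μ := volume) (measurableSet_Icc (a := (-1 : ℝ)) (b := 1))]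
      with x hx using abs_le.2 hx
  exact (measurePreserving_eval_infinitePi (fun _ : ℕ => symmetricUniform)
    k).quasiMeasurePreserving.ae h1

theorem ae_noise_not_regular {ε : ℝ} (hε : 0 < ε) : ∀ᵐ a ∂uniformSequence,
    (∀ k, |a k| ≤ 1) ∧ ∀ ζ ∈ sphere (0 : ℂ) 1, ¬ IsRegularPoint (noise ε a) (ball 0 1) ζ := by
  obtain ⟨D, hDc, hDs, hD⟩ : ∃ D : Set ℂ, D.Countable ∧ D ⊆ sphere 0 1 ∧
      sphere (0 : ℂ) 1 ⊆ closure D := by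
    obtain ⟨D, hDs, hDc, hD⟩ :=
      (TopologicalSpace.IsSeparable.of_separableSpace
        (sphere (0 : ℂ) 1)).exists_countable_dense_subset
    exact ⟨D, hDc, hDs, hD⟩
  have hnull : ∀ᵐ a ∂uniformSequence, ∀ ζ ∈ D, ∀ m C : ℕ,
      a ∉ lipschitzNoise ε ζ (1 / ((m : ℝ) + 1)) C := by
    rw [ae_ball_iff hDc]
    intro ζ hζ'
    rw [ae_all_iff]
    intro m
    rw [ae_all_iff]
    intro C
    exact measure_eq_zero_iff_ae_notMem.1 (measure_lipschitzNoise hε (by positivity) C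
      (mem_sphere_zero_iff_norm.1 (hDs hζ')))
  filter_upwards [hnull, ae_abs_le_one] with a ha hb
  refine ⟨hb, fun ζ hζ hreg => ?_⟩
  -- The centre, radius and constant are replaced by members of the countable families. Halving `δ`
  -- pays for both the shift of the centre and the new radius.
  obtain ⟨δ, hδ, C, hC⟩ := exists_mem_lipschitzNoise hb hreg
  obtain ⟨m, hm⟩ := exists_nat_one_div_lt (half_pos hδ)
  obtain ⟨C', hC'⟩ := exists_nat_ge C
  obtain ⟨ζ', hζ', hd⟩ := Metric.mem_closure_iff.1 (hD hζ) (δ / 2) (half_pos hδ)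
  refine ha ζ' hζ' m C' (lipschitzNoise_mono hC' (ball_subset_ball' ?_) hC)
  rw [dist_comm]
  linarith

end NoiseSeries

namespace NoiseSeries

/-! ### Composition with the inverse function -/

/-- The radius of convergence of the Taylor series of a function holomorphic in a disk is at least
the radius of the disk. -/
theorem le_radius_of_differentiableOn_ball {Φ : ℂ → ℂ} {p : FormalMultilinearSeries ℂ ℂ ℂ} {R : ℝ}
    (hΦ : DifferentiableOn ℂ Φ (ball 0 R)) (hp : HasFPowerSeriesAt Φ p 0) :
    ENNReal.ofReal R ≤ p.radius := by
  refine ENNReal.le_of_forall_nnreal_lt fun t ht => ?_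
  rcases eq_or_ne t 0 with rfl | ht0
  · simp
  have htR : (t : ℝ) < R := by
    rw [ENNReal.lt_ofReal_iff_toReal_lt ENNReal.coe_ne_top] at ht
    simpa using ht
  have h1 : HasFPowerSeriesOnBall Φ (cauchyPowerSeries Φ 0 t) 0 t :=
    (hΦ.mono (closedBall_subset_ball htR)).hasFPowerSeriesOnBall (pos_iff_ne_zero.2 ht0)
  rw [hp.eq_formalMultilinearSeries h1.hasFPowerSeriesAt]
  exact h1.r_le

theorem limsup_enorm_coeff_rpow (p : FormalMultilinearSeries ℂ ℂ ℂ) :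
    limsup (fun k : ℕ => ‖p.coeff k‖ₑ ^ (1 / (k : ℝ))) atTop = p.radius⁻¹ := by
  rw [p.radius_inv_eq_limsup]
  congr 1
  funext k
  rw [ENNReal.coe_rpow_of_nonneg _ (by positivity)]
  congr 1
  simp [enorm, nnnorm]

namespace DiskBranch

variable {f g F : ℂ → ℂ} {B : Set ℂ}

theorem mapsTo_image (H : DiskBranch f g B) : MapsTo f (g '' ball 0 1) (ball 0 1) := by
  rintro _ ⟨w, hw, rfl⟩
  rwa [H.rightInv w hw]

theorem differentiableOn_comp (H : DiskBranch f g B) (hF : DifferentiableOn ℂ F (ball 0 1)) :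
    DifferentiableOn ℂ (fun z => F (f z)) (g '' ball 0 1) :=
  hF.fun_comp (H.differentiableOn.mono H.mapsTo.image_subset) H.mapsTo_image

/-- A continuation at a point of the curve is also one at the points ψ(ω) nearby, which are dense in
the curve. Composed with the chart at ω, it would continue `F` across ω. -/
theorem isNaturalBoundary_comp (H : DiskBranch f g B) (hF : DifferentiableOn ℂ F (ball 0 1))
    (hreg : ∀ ω ∈ sphere (0 : ℂ) 1, ¬ IsRegularPoint F (ball 0 1) ω) :
    IsNaturalBoundary (fun z => F (f z)) (g '' ball 0 1) (valueCurve g B) := by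
  refine ⟨H.isOpen_image, H.isConnected_image, H.differentiableOn_comp hF,
    H.valueCurve_subset_frontier, ?_⟩
  rintro ζ hζ ⟨k, hk, hkeq⟩
  rw [EventuallyEq, eventually_nhdsWithin_iff] at hkeq
  obtain ⟨W, hW, hWo, hζW⟩ := _root_.eventually_nhds_iff.1 (hk.eventually_analyticAt.and hkeq)
  obtain ⟨_, hωW, ω, ⟨hω, hB⟩, rfl⟩ := mem_closure_iff.1 hζ W hWo hζW
  have hω' := sphere_subset_closedBall hω
  obtain ⟨h, r, hr, hd, hm, hR, hL, hE, -⟩ := H.exists_chart hω' hB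
  have hha : AnalyticAt ℂ h ω := hd.analyticAt (ball_mem_nhds ω hr)
  rw [hE ⟨mem_ball_self hr, hω'⟩] at hωW
  refine hreg ω hω ⟨fun w => k (h w), AnalyticAt.fun_comp (hW _ hωW).1 hha, ?_⟩
  filter_upwards [self_mem_nhdsWithin, mem_nhdsWithin_of_mem_nhds (ball_mem_nhds ω hr),
    mem_nhdsWithin_of_mem_nhds (hha.continuousAt (hWo.mem_nhds hωW))] with w h₁ h₂ h₃
  have hgw : h w ∈ g '' ball 0 1 := by
    refine ⟨w, h₁, ?_⟩
    rw [← H.diskExtend_of_mem h₁, hE ⟨h₂, ball_subset_closedBall h₁⟩]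
  rw [← (hW _ h₃).2 hgw, hR w h₂]

/-- A larger radius would make the sum of the series analytic at `ζ`, the value at some ω in the
circle. The sum is known to equal `F ∘ f` only on the disk of radius `‖ζ‖`, so equality with `F`
after composing with the chart is seeded at a point of that disk close to `ζ` and spread over a lens
at ω by the identity theorem. -/
theorem exists_taylor_radius_eq (H : DiskBranch f g B) (hF : DifferentiableOn ℂ F (ball 0 1))
    (hreg : ∀ ω ∈ sphere (0 : ℂ) 1, ¬ IsRegularPoint F (ball 0 1) ω) {ζ : ℂ}
    (hζ : ζ ∈ valueCurve g B) (hmin : IsMinOn (fun z => ‖z‖) (valueCurve g B) ζ) :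
    ∃ p : FormalMultilinearSeries ℂ ℂ ℂ, HasFPowerSeriesAt (fun z => F (f z)) p 0 ∧
      p.radius = ‖ζ‖ₑ := by
  have hpos : 0 < ‖ζ‖ := norm_pos_iff.2 (H.ne_zero_of_mem_valueCurve hζ)
  have hsub := H.ball_subset_image_of_isMinOn hmin
  have hΦ : DifferentiableOn ℂ (fun z => F (f z)) (ball 0 ‖ζ‖) :=
    (H.differentiableOn_comp hF).mono hsub
  obtain ⟨p, hp⟩ := hΦ.analyticAt (ball_mem_nhds 0 hpos)
  refine ⟨p, hp, le_antisymm ?_ ?_⟩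
  swap
  · rw [← ofReal_norm]
    exact le_radius_of_differentiableOn_ball hΦ hp
  by_contra! hlt
  have hrad : 0 < p.radius := zero_le.trans_lt hlt
  have hT := p.hasFPowerSeriesOnBall hrad
  have hTΦ : EqOn p.sum (fun z => F (f z)) (ball 0 ‖ζ‖) := by
    refine AnalyticOnNhd.eqOn_of_preconnected_of_eventuallyEq (𝕜 := ℂ) (fun z hz => ?_)
      (hΦ.analyticOnNhd isOpen_ball) (convex_ball 0 ‖ζ‖).isPreconnected (mem_ball_self hpos) ?_
    · refine hT.analyticAt_of_mem (mem_eball_zero_iff.2 (lt_trans ?_ hlt))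
      rw [← ofReal_norm, ← ofReal_norm]
      exact (ENNReal.ofReal_lt_ofReal_iff hpos).2 (mem_ball_zero_iff.1 hz)
    · have h1 := hp.eventually_hasSum
      have h2 := hT.hasFPowerSeriesAt.eventually_hasSum
      filter_upwards [h1, h2] with y h₁ h₂
      simpa using h₂.unique h₁
  have hb : ζ ∈ valueCurve g B ∩ ball 0 1 :=
    ⟨hζ, mem_ball_zero_iff.2 (H.norm_lt_one_of_isMinOn hmin)⟩
  rw [H.valueCurve_inter_ball] at hb
  obtain ⟨ω, ⟨hω, hB⟩, hωζ⟩ := hb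
  have hω' := sphere_subset_closedBall hω
  obtain ⟨h, r, hr, hd, hm, hR, hL, hE, -⟩ := H.exists_chart hω' hB
  have hhω : h ω = ζ := by rw [← hωζ, hE ⟨mem_ball_self hr, hω'⟩]
  rw [hhω] at hL
  have hha : AnalyticAt ℂ h ω := hd.analyticAt (ball_mem_nhds ω hr)
  have hTa : ∀ᶠ w in 𝓝 ω, AnalyticAt ℂ p.sum (h w) := by
    refine hha.continuousAt.eventually ?_
    rw [hhω]
    exact (hT.analyticAt_of_mem (mem_eball_zero_iff.2 hlt)).eventually_analyticAt
  obtain ⟨s, hs, hsub'⟩ := Metric.eventually_nhds_iff_ball.1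
    (hTa.and (hha.eventually_analyticAt.and (ball_mem_nhds ω hr)))
  have hfζ : f ζ = ω := by rw [← hωζ, H.apply_diskExtend hω' hB]
  have hfc : ContinuousAt f ζ := (H.analyticAt (hωζ ▸ H.diskExtend_mem hω' hB)).continuousAt
  have hζcl : ζ ∈ closure (ball (0 : ℂ) ‖ζ‖) := by
    rw [closure_ball _ hpos.ne']
    simp
  obtain ⟨z, hz, hzL, hzs⟩ := ((mem_closure_iff_frequently.1 hζcl).and_eventually
    (hL.and (hfc.eventually_mem (by rw [hfζ]; exact ball_mem_nhds ω hs)))).exists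
  have hfz : f z ∈ ball ω s ∩ ball 0 1 := ⟨hzs, H.mapsTo_image (hsub hz)⟩
  have hEq : EqOn (fun w => p.sum (h w)) F (ball ω s ∩ ball 0 1) := by
    refine AnalyticOnNhd.eqOn_of_preconnected_of_eventuallyEq (𝕜 := ℂ)
      (fun w hw => (hsub' w hw.1).1.fun_comp (hsub' w hw.1).2.1)
      (fun w hw => hF.analyticAt (isOpen_ball.mem_nhds hw.2))
      ((convex_ball ω s).inter (convex_ball 0 1)).isPreconnected hfz ?_
    have hhc : ContinuousAt h (f z) := (hsub' _ hzs).2.1.continuousAt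
    filter_upwards [hhc.eventually_mem (by rw [hzL]; exact isOpen_ball.mem_nhds hz),
      isOpen_ball.mem_nhds hzs] with w h₁ h₂
    rw [hTΦ h₁]
    simp only [hR w (hsub' w h₂).2.2]
  refine hreg ω hω ⟨fun w => p.sum (h w),
    (hsub' ω (mem_ball_self hs)).1.fun_comp hha, ?_⟩
  filter_upwards [self_mem_nhdsWithin, mem_nhdsWithin_of_mem_nhds (ball_mem_nhds ω hs)]
    with w h₁ h₂ using (hEq ⟨h₂, h₁⟩).symm

end DiskBranch

end NoiseSeries

namespace NoiseSeries

/-! ### Area and radial limits -/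

theorem abs_det_restrictScalars_toSpanSingleton (a : ℂ) :
    |((ContinuousLinearMap.toSpanSingleton ℂ a).restrictScalars ℝ : ℂ →L[ℝ] ℂ).det| = ‖a‖ ^ 2 := by
  have h : (((ContinuousLinearMap.toSpanSingleton ℂ a).restrictScalars ℝ : ℂ →L[ℝ] ℂ) :
      ℂ →ₗ[ℝ] ℂ) = Algebra.lmul ℝ ℂ a := by
    ext; simp [mul_comm]
  rw [ContinuousLinearMap.det, h, ← Algebra.norm_apply, Algebra.norm_complex_apply,
    Complex.normSq_eq_norm_sq, abs_of_nonneg (by positivity)]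

/-- The derivative of a bounded univalent function on the unit disk is integrable. -/
theorem lintegral_enorm_deriv_ne_top {u : ℂ → ℂ} (hd : DifferentiableOn ℂ u (ball 0 1))
    (hinj : InjOn u (ball 0 1)) {M : ℝ} (hb : ∀ z ∈ ball (0 : ℂ) 1, ‖u z‖ ≤ M) :
    ∫⁻ z in ball (0 : ℂ) 1, ‖deriv u z‖ₑ ≠ ⊤ := by
  have harea : ∫⁻ z in ball (0 : ℂ) 1, ‖deriv u z‖ₑ ^ 2 = volume (u '' ball 0 1) := by
    have := lintegral_image_eq_lintegral_abs_det_fderiv_mul (E := ℂ) volume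
      (measurableSet_ball (x := (0 : ℂ)) (ε := 1)) (f := u)
      (f' := fun z => (ContinuousLinearMap.toSpanSingleton ℂ (deriv u z)).restrictScalars ℝ)
      (fun z hz => ((hd.hasDerivAt (isOpen_ball.mem_nhds hz)).hasFDerivAt.restrictScalars
        ℝ).hasFDerivWithinAt) hinj (fun _ => 1)
    rw [setLIntegral_one] at this
    rw [this]
    refine lintegral_congr fun z => ?_
    rw [abs_det_restrictScalars_toSpanSingleton, mul_one, ENNReal.ofReal_pow (norm_nonneg _),
      ofReal_norm]
  have hfin : volume (u '' ball 0 1) < ⊤ := by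
    refine (measure_mono ?_).trans_lt (measure_closedBall_lt_top (x := (0 : ℂ)) (r := M))
    rintro _ ⟨z, hz, rfl⟩
    exact mem_closedBall_zero_iff.2 (hb z hz)
  -- The square of the derivative integrates to the area of the image, which is finite, and t ≤ 1 +
  -- t².
  refine ne_top_of_le_ne_top (b := ∫⁻ z in ball (0 : ℂ) 1, (1 + ‖deriv u z‖ₑ ^ 2)) ?_
    (lintegral_mono fun z => ?_)
  · rw [lintegral_add_left measurable_const, harea, setLIntegral_one]
    exact ENNReal.add_ne_top.2 ⟨measure_ball_lt_top.ne, hfin.ne⟩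
  · rcases le_total ‖deriv u z‖ₑ 1 with h | h
    · exact h.trans le_self_add
    · exact (le_self_pow h two_ne_zero).trans le_add_self

theorem tendsto_volume_annulus :
    Tendsto (fun r : ℝ => volume (ball (0 : ℂ) 1 \ closedBall 0 r)) (𝓝[<] 1) (𝓝 0) := by
  have h1 : (fun r : ℝ => volume (ball (0 : ℂ) 1) - volume (closedBall (0 : ℂ) r)) =ᶠ[𝓝[<] 1]
      fun r : ℝ => volume (ball (0 : ℂ) 1 \ closedBall 0 r) := by
    filter_upwards [self_mem_nhdsWithin] with r hr
    rw [measure_sdiff (closedBall_subset_ball hr) measurableSet_closedBall.nullMeasurableSet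
      measure_closedBall_lt_top.ne]
  refine Tendsto.congr' h1 ?_
  simp_rw [Complex.volume_closedBall, Complex.volume_ball]
  have h2 : Tendsto (fun r : ℝ => ENNReal.ofReal r ^ 2 * (NNReal.pi : ENNReal)) (𝓝[<] 1)
      (𝓝 (ENNReal.ofReal 1 ^ 2 * NNReal.pi)) := by
    refine Tendsto.mono_left ?_ nhdsWithin_le_nhds
    refine ENNReal.Tendsto.mul_const ?_ (Or.inr ENNReal.coe_ne_top)
    exact ((ENNReal.continuous_pow 2).comp ENNReal.continuous_ofReal).tendsto 1
  have h3 := ENNReal.Tendsto.sub (a := ENNReal.ofReal 1 ^ 2 * (NNReal.pi : ENNReal))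
    (tendsto_const_nhds (f := 𝓝[<] (1 : ℝ))) h2 (Or.inl (by simp))
  rwa [tsub_self] at h3

/-- Integrate the derivative along the radius out to a point where `H` is at most ε in norm. -/
theorem enorm_le_lintegral_radius {H : ℂ → ℂ} (hd : DifferentiableOn ℂ H (ball 0 1)) {θ : ℝ}
    (hrad : ∀ r < (1 : ℝ), ∀ ε > (0 : ℝ), ∃ s, r < s ∧ s < 1 ∧
      ‖H (s * Complex.exp (θ * Complex.I))‖ ≤ ε) {r : ℝ} (hr : 0 ≤ r) (hr1 : r < 1) :
    ‖H (r * Complex.exp (θ * Complex.I))‖ₑ ≤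
      ∫⁻ t in Ioo r 1, ‖deriv H (t * Complex.exp (θ * Complex.I))‖ₑ := by
  set e := Complex.exp (θ * Complex.I) with he
  have hen : ‖e‖ = 1 := Complex.norm_exp_ofReal_mul_I θ
  have hmem : ∀ t : ℝ, 0 ≤ t → t < 1 → (t : ℂ) * e ∈ ball (0 : ℂ) 1 := fun t h0 h1 => by
    rw [mem_ball_zero_iff, norm_mul, hen, mul_one, Complex.norm_real, Real.norm_of_nonneg h0]
    exact h1
  have hderiv : ∀ t : ℝ, 0 ≤ t → t < 1 →
      HasDerivAt (fun t : ℝ => H (t * e)) (deriv H (t * e) * e) t := fun t h0 h1 => by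
    have h2 := hd.hasDerivAt (isOpen_ball.mem_nhds (hmem t h0 h1))
    have h3 : HasDerivAt (fun z : ℂ => H (z * e)) (deriv H (t * e) * e) (t : ℂ) := by
      have h4 : HasDerivAt (fun z : ℂ => z * e) e (t : ℂ) := by
        simpa using (hasDerivAt_id (t : ℂ)).mul_const e
      exact h2.comp (t : ℂ) h4
    exact h3.comp_ofReal
  refine ENNReal.le_of_forall_pos_le_add fun ε hε _ => ?_
  obtain ⟨s, hrs, hs1, hs⟩ := hrad r hr1 ε hε
  have hC : ContDiffOn ℝ 1 (fun t : ℝ => H (t * e)) (Icc r s) := by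
    intro t ht
    have h1 := (hd.analyticAt (isOpen_ball.mem_nhds (hmem t (hr.trans ht.1) (ht.2.trans_lt hs1))))
    have h2 : ContDiffAt ℝ 1 H (t * e) := (h1.contDiffAt (n := 1)).restrict_scalars ℝ
    have h3 : ContDiffAt ℝ 1 (fun t : ℝ => (t : ℂ) * e) t :=
      (Complex.ofRealCLM.contDiff.mul contDiff_const).contDiffAt
    exact (ContDiffAt.comp (g := H) t h2 h3).contDiffWithinAt
  have h1 := enorm_sub_le_lintegral_deriv_of_contDiffOn_Icc hC hrs.le
  have h2 : ∫⁻ t in Icc r s, ‖deriv (fun t : ℝ => H (t * e)) t‖ₑ ≤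
      ∫⁻ t in Ioo r 1, ‖deriv H (t * e)‖ₑ := by
    calc _ = ∫⁻ t in Icc r s, ‖deriv H (t * e)‖ₑ := by
            refine setLIntegral_congr_fun measurableSet_Icc fun t ht => ?_
            simp only [(hderiv t (hr.trans ht.1) (ht.2.trans_lt hs1)).deriv]
            rw [← ofReal_norm, ← ofReal_norm, norm_mul, hen, mul_one]
      _ ≤ ∫⁻ t in Ico r 1, ‖deriv H (t * e)‖ₑ :=
            lintegral_mono_set fun t ht => ⟨ht.1, ht.2.trans_lt hs1⟩
      _ = _ := setLIntegral_congr Ioo_ae_eq_Ico.symm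
  have h3 : ‖H (r * e)‖ₑ ≤ ‖H (s * e) - H (r * e)‖ₑ + ‖H (s * e)‖ₑ := by
    rw [← enorm_neg (H (s * e) - H (r * e))]
    refine le_trans (le_of_eq ?_) (enorm_add_le _ _)
    congr 1
    ring
  refine h3.trans (add_le_add (h1.trans h2) ?_)
  rw [← ofReal_norm]
  exact ENNReal.ofReal_le_of_le_toReal (by simpa using hs)

theorem enorm_mul_le_lintegral_circle {H : ℂ → ℂ} (hd : DifferentiableOn ℂ H (ball 0 1))
    {r : ℝ} (hr : 0 ≤ r) (hr1 : r < 1) :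
    ‖H 0‖ₑ * ENNReal.ofReal (2 * Real.pi) ≤
      ∫⁻ θ in Ioo (-Real.pi) Real.pi, ‖H (r * Complex.exp (θ * Complex.I))‖ₑ := by
  have hpi := Real.pi_pos
  have h1 : Real.circleAverage H 0 r = H 0 := by
    refine DiffContOnCl.circleAverage ((hd.mono ?_).diffContOnCl)
    rw [abs_of_nonneg hr]
    exact closure_ball_subset_closedBall.trans (closedBall_subset_ball hr1)
  rw [Real.circleAverage_eq_integral_add (-Real.pi),
    intervalIntegral.integral_comp_add_right (fun θ => H (circleMap 0 r θ))] at h1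
  have h2 : H 0 * (2 * Real.pi : ℝ) = ∫ θ in (-Real.pi)..Real.pi, H (circleMap 0 r θ) := by
    rw [← h1, zero_add, two_mul, add_neg_cancel_right, Complex.real_smul, ← two_mul]
    rw [mul_comm, ← mul_assoc, ← Complex.ofReal_mul, mul_inv_cancel₀ (by positivity)]
    simp
  have h3 : ‖H 0‖ₑ * ENNReal.ofReal (2 * Real.pi) = ‖H 0 * (2 * Real.pi : ℝ)‖ₑ := by
    rw [enorm_mul, ← ofReal_norm ((2 * Real.pi : ℝ) : ℂ), Complex.norm_real,
      Real.norm_of_nonneg (by positivity)]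
  rw [h3, h2, intervalIntegral.integral_of_le (by linarith)]
  refine (enorm_integral_le_lintegral_enorm _).trans (le_of_eq ?_)
  rw [setLIntegral_congr Ioo_ae_eq_Ioc.symm]
  simp [circleMap]

/-- Polar coordinates: the Jacobian is at least 1/2 on the annulus, whence the factor 2. -/
theorem lintegral_annulus_le {G : ℂ → ENNReal} (hG : Measurable G) {r : ℝ} (hr : 1 / 2 ≤ r) :
    ∫⁻ θ in Ioo (-Real.pi) Real.pi, ∫⁻ t in Ioo r 1, G (t * Complex.exp (θ * Complex.I)) ≤
      2 * ∫⁻ z in ball (0 : ℂ) 1 \ closedBall 0 r, G z := by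
  set A : Set ℂ := ball (0 : ℂ) 1 \ closedBall 0 r with hA
  have hAm : MeasurableSet A := measurableSet_ball.diff measurableSet_closedBall
  have hpolar := Complex.lintegral_comp_polarCoord_symm (A.indicator G)
  rw [lintegral_indicator hAm] at hpolar
  have hmeas : Measurable fun p : ℝ × ℝ => G (p.1 * Complex.exp (p.2 * Complex.I)) :=
    hG.comp (by fun_prop)
  have h1 : ∫⁻ θ in Ioo (-Real.pi) Real.pi, ∫⁻ t in Ioo r 1, G (t * Complex.exp (θ * Complex.I)) =
      ∫⁻ p in Ioo r 1 ×ˢ Ioo (-Real.pi) Real.pi, G (p.1 * Complex.exp (p.2 * Complex.I)) := by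
    rw [Measure.volume_eq_prod, setLIntegral_prod_symm _ hmeas.aemeasurable]
  rw [h1, ← hpolar]
  have hsub : Ioo r 1 ×ˢ Ioo (-Real.pi) Real.pi ⊆ Complex.polarCoord.target := by
    rw [Complex.polarCoord_target]
    exact prod_mono (fun t ht => lt_trans (by linarith) ht.1) Subset.rfl
  calc _ ≤ ∫⁻ p in Ioo r 1 ×ˢ Ioo (-Real.pi) Real.pi,
        2 * (ENNReal.ofReal p.1 • A.indicator G (Complex.polarCoord.symm p)) := by
        refine setLIntegral_mono' (measurableSet_Ioo.prod measurableSet_Ioo) fun p hp => ?_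
        have hp0 : 0 < p.1 := lt_of_lt_of_le (by norm_num) (hr.trans hp.1.1.le)
        have hsymm : Complex.polarCoord.symm p = p.1 * Complex.exp (p.2 * Complex.I) := by
          rw [Complex.polarCoord_symm_apply, Complex.exp_mul_I, Complex.ofReal_cos,
            Complex.ofReal_sin]
        have hn : ‖(p.1 : ℂ) * Complex.exp (p.2 * Complex.I)‖ = p.1 := by
          rw [norm_mul, Complex.norm_exp_ofReal_mul_I, mul_one, Complex.norm_real,
            Real.norm_of_nonneg hp0.le]
        have hmemA : (p.1 : ℂ) * Complex.exp (p.2 * Complex.I) ∈ A := by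
          refine ⟨?_, ?_⟩
          · rw [mem_ball_zero_iff, hn]; exact hp.1.2
          · rw [mem_closedBall_zero_iff, hn]; exact not_le.2 hp.1.1
        rw [hsymm, indicator_of_mem hmemA, smul_eq_mul, ← mul_assoc]
        refine le_mul_of_one_le_left zero_le ?_
        rw [← ENNReal.ofReal_ofNat 2, ← ENNReal.ofReal_mul (by norm_num), ← ENNReal.ofReal_one]
        exact ENNReal.ofReal_le_ofReal (by linarith [hp.1.1])
    _ = 2 * ∫⁻ p in Ioo r 1 ×ˢ Ioo (-Real.pi) Real.pi,
          (ENNReal.ofReal p.1 • A.indicator G (Complex.polarCoord.symm p)) :=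
        lintegral_const_mul' _ _ (by simp)
    _ ≤ _ := by
        gcongr
        exact hsub

/-- The mean value property bounds 2π‖H 0‖ by the integral of ‖H‖ over a circle, and the radial
estimate bounds that by twice the integral of ‖H'‖ over the outer annulus. This tends to 0 as the
annulus shrinks. -/
theorem eq_zero_of_radially_small {H : ℂ → ℂ} (hd : DifferentiableOn ℂ H (ball 0 1))
    (hint : ∫⁻ z in ball (0 : ℂ) 1, ‖deriv H z‖ₑ ≠ ⊤)
    (hrad : ∀ θ : ℝ, ∀ r < (1 : ℝ), ∀ ε > (0 : ℝ), ∃ s, r < s ∧ s < 1 ∧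
      ‖H (s * Complex.exp (θ * Complex.I))‖ ≤ ε) : H 0 = 0 := by
  have hlim : Tendsto (fun r : ℝ => 2 * ∫⁻ z in ball (0 : ℂ) 1 \ closedBall 0 r, ‖deriv H z‖ₑ)
      (𝓝[<] 1) (𝓝 0) := by
    have h1 := tendsto_setLIntegral_zero (μ := volume.restrict (ball (0 : ℂ) 1)) hint
      (s := fun r : ℝ => ball (0 : ℂ) 1 \ closedBall 0 r) (l := 𝓝[<] (1 : ℝ)) (by
        refine tendsto_of_tendsto_of_tendsto_of_le_of_le tendsto_const_nhds tendsto_volume_annulus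
          (fun _ => zero_le) fun r => Measure.restrict_apply_le _ _)
    have h2 := ENNReal.Tendsto.const_mul h1 (a := 2) (Or.inr (by simp))
    rw [mul_zero] at h2
    refine h2.congr fun r => ?_
    rw [Measure.restrict_restrict (measurableSet_ball.diff measurableSet_closedBall),
      inter_eq_left.2 sdiff_subset]
  have hle : ‖H 0‖ₑ * ENNReal.ofReal (2 * Real.pi) ≤ 0 := by
    refine ge_of_tendsto hlim ?_
    filter_upwards [Ioo_mem_nhdsLT (show (1 / 2 : ℝ) < 1 by norm_num)] with r hr
    have hr0 : 0 ≤ r := by linarith [hr.1]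
    refine (enorm_mul_le_lintegral_circle hd hr0 hr.2).trans ?_
    refine le_trans (lintegral_mono fun θ => enorm_le_lintegral_radius hd (hrad θ) hr0 hr.2) ?_
    exact lintegral_annulus_le (measurable_deriv H).enorm hr.1.le
  have h0 := le_antisymm hle zero_le
  rw [mul_eq_zero] at h0
  rcases h0 with h | h
  · exact enorm_eq_zero.1 h
  · rw [ENNReal.ofReal_eq_zero] at h
    linarith [Real.pi_pos]

end NoiseSeries

namespace NoiseSeries

/-! ### Univalent functions that are small along rotated radii -/

theorem lintegral_enorm_deriv_rotate (u : ℂ → ℂ) {η : ℂ} (hη : ‖η‖ = 1) :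
    ∫⁻ z in ball (0 : ℂ) 1, ‖deriv u (η * z)‖ₑ = ∫⁻ z in ball (0 : ℂ) 1, ‖deriv u z‖ₑ := by
  have hmp := (rotation (⟨η, mem_sphere_zero_iff_norm.2 hη⟩ : Circle)).measurePreserving
  have := hmp.setLIntegral_comp_preimage (measurableSet_ball (x := (0 : ℂ)) (ε := 1))
    (measurable_deriv u).enorm
  rw [← this]
  congr 2
  ext z
  simp

/-- A univalent function from the unit disk to itself vanishes at `0` if, for some `m`, every
radius has one of its `m` rotations along which the function is not bounded away from zero near
the unit circle. -/
theorem eq_zero_of_rotations_radially_small {u : ℂ → ℂ} (hd : DifferentiableOn ℂ u (ball 0 1))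
    (hinj : InjOn u (ball 0 1)) (hb : ∀ z ∈ ball (0 : ℂ) 1, ‖u z‖ ≤ 1) {m : ℕ} {η : ℂ}
    (hη : ‖η‖ = 1) (hrad : ∀ θ : ℝ, ∃ i < m, ∀ r < (1 : ℝ), ∀ ε > (0 : ℝ), ∃ s, r < s ∧ s < 1 ∧
      0 ≤ s ∧ ‖u (η ^ i * (s * Complex.exp (θ * Complex.I)))‖ ≤ ε) : u 0 = 0 := by
  have hηi : ∀ i : ℕ, ‖η ^ i‖ = 1 := fun i => by rw [norm_pow, hη, one_pow]
  have hmem : ∀ i : ℕ, ∀ z ∈ ball (0 : ℂ) 1, η ^ i * z ∈ ball (0 : ℂ) 1 := fun i z hz => by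
    rw [mem_ball_zero_iff] at hz ⊢
    rwa [norm_mul, hηi, one_mul]
  have hderiv : ∀ i : ℕ, ∀ z ∈ ball (0 : ℂ) 1,
      HasDerivAt (fun z => u (η ^ i * z)) (deriv u (η ^ i * z) * η ^ i) z := fun i z hz => by
    have h1 := hd.hasDerivAt (isOpen_ball.mem_nhds (hmem i z hz))
    have h2 : HasDerivAt (fun z : ℂ => η ^ i * z) (η ^ i) z := by
      simpa using (hasDerivAt_id z).const_mul (η ^ i)
    exact h1.comp z h2
  -- The product over the rotations is small along every radius, since one factor is small and the
  -- others are at most 1. For the same reason its derivative is dominated by the sum of the rotated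
  -- derivatives.
  set H : ℂ → ℂ := fun z => ∏ i ∈ Finset.range m, u (η ^ i * z) with hH
  have hHd : ∀ z ∈ ball (0 : ℂ) 1, HasDerivAt H _ z := fun z hz =>
    HasDerivAt.fun_finsetProd (u := Finset.range m) fun i _ => hderiv i z hz
  have hH0 : H 0 = 0 := by
    refine eq_zero_of_radially_small
      (fun z hz => (hHd z hz).differentiableAt.differentiableWithinAt) ?_ ?_
    · refine ne_top_of_le_ne_top (b := ∫⁻ z in ball (0 : ℂ) 1,
        ∑ i ∈ Finset.range m, ‖deriv u (η ^ i * z)‖ₑ) ?_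
        (setLIntegral_mono' measurableSet_ball fun z hz => ?_)
      · rw [lintegral_finsetSum _ fun i _ => Measurable.enorm (f := fun z => deriv u (η ^ i * z))
          ((measurable_deriv u).comp (measurable_const_mul _))]
        refine ENNReal.sum_ne_top.2 fun i _ => ?_
        rw [lintegral_enorm_deriv_rotate u (hηi i)]
        exact lintegral_enorm_deriv_ne_top hd hinj hb
      · rw [(hHd z hz).deriv]
        refine (enorm_sum_le _ _).trans (Finset.sum_le_sum fun i _ => ?_)
        rw [← ofReal_norm, ← ofReal_norm]
        refine ENNReal.ofReal_le_ofReal ?_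
        rw [smul_eq_mul, norm_mul, norm_mul, hηi, mul_one, norm_prod]
        refine mul_le_of_le_one_left (norm_nonneg _) (Finset.prod_le_one
          (fun _ _ => norm_nonneg _) fun j _ => hb _ (hmem j z hz))
    · intro θ r hr ε hε
      obtain ⟨i, hi, h⟩ := hrad θ
      obtain ⟨s, hrs, hs1, hs0, hs⟩ := h r hr ε hε
      refine ⟨s, hrs, hs1, ?_⟩
      have hsm : (s : ℂ) * Complex.exp (θ * Complex.I) ∈ ball (0 : ℂ) 1 := by
        rw [mem_ball_zero_iff, norm_mul, Complex.norm_exp_ofReal_mul_I, mul_one,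
          Complex.norm_real, Real.norm_of_nonneg hs0]
        exact hs1
      rw [hH]
      simp only
      rw [norm_prod, ← Finset.mul_prod_erase _ _ (Finset.mem_range.2 hi)]
      refine (mul_le_of_le_one_right (norm_nonneg _) (Finset.prod_le_one
          (fun _ _ => norm_nonneg _) fun j _ => hb _ (hmem j _ hsm))).trans hs
  rw [hH] at hH0
  obtain ⟨i, -, hi⟩ := Finset.prod_eq_zero_iff.1 hH0
  rwa [mul_zero] at hi

theorem isSimplyConnected_of_convex {S : Set ℂ} (hS : Convex ℝ S) (hne : S.Nonempty) :
    IsSimplyConnected S := by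
  have := hS.contractibleSpace hne
  exact (inferInstance : SimplyConnectedSpace S)

/-- A univalent function on the disk omitting the value `ω` has a bounded univalent companion
which is nonzero at `0` and small where the function is close to `ω`. -/
theorem exists_bounded_univalent {f : ℂ → ℂ} {ω : ℂ} (hd : DifferentiableOn ℂ f (ball 0 1))
    (hinj : InjOn f (ball 0 1)) (hω : ∀ z ∈ ball (0 : ℂ) 1, f z ≠ ω) :
    ∃ u : ℂ → ℂ, DifferentiableOn ℂ u (ball 0 1) ∧ InjOn u (ball 0 1) ∧
      (∀ z ∈ ball (0 : ℂ) 1, ‖u z‖ ≤ 1) ∧ u 0 ≠ 0 ∧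
      ∃ c : ℝ, ∀ z ∈ ball (0 : ℂ) 1, ‖u z‖ ^ 2 ≤ c * ‖f z - ω‖ := by
  have h00 : (0 : ℂ) ∈ ball (0 : ℂ) 1 := mem_ball_self one_pos
  obtain ⟨q, hqc, hq⟩ := Complex.exists_continuousOn_pow_eq
    (isSimplyConnected_of_convex (convex_ball (0 : ℂ) 1) ⟨0, h00⟩) isOpen_ball
    (g := fun z => f z - ω) (hd.continuousOn.sub continuousOn_const)
    (by rintro ⟨z, hz, h⟩; exact hω z hz (sub_eq_zero.1 h)) two_ne_zero
  have hq0 : ∀ z ∈ ball (0 : ℂ) 1, q z ≠ 0 := fun z hz h => by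
    have := hq z
    rw [h, zero_pow two_ne_zero] at this
    exact hω z hz (sub_eq_zero.1 this.symm)
  have hqa : AnalyticOnNhd ℂ q (ball 0 1) := by
    intro z hz
    have hsq : AnalyticAt ℂ (fun y : ℂ => y ^ 2) (q z) := by fun_prop
    have hsq' : deriv (fun y : ℂ => y ^ 2) (q z) ≠ 0 := by simpa using hq0 z hz
    have hL : ∀ᶠ y in 𝓝 (q z), hsq.hasStrictDerivAt.localInverse _ _ _ hsq' (y ^ 2) = y :=
      HasStrictDerivAt.eventually_left_inverse ..
    have hr := hsq.analyticAt_localInverse hsq'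
    have hF : AnalyticAt ℂ (fun z => f z - ω) z :=
      (hd.analyticAt (isOpen_ball.mem_nhds hz)).sub analyticAt_const
    refine (AnalyticAt.comp (f := fun z => f z - ω) (x := z) (by simpa [hq z] using hr)
      hF).congr ?_
    filter_upwards [(hqc.continuousAt (isOpen_ball.mem_nhds hz)).eventually hL] with y hy
    rw [Function.comp_apply, ← hq y]
    exact hy
  have hqinj : ∀ z ∈ ball (0 : ℂ) 1, ∀ y ∈ ball (0 : ℂ) 1, q z ^ 2 = q y ^ 2 → z = y :=
    fun z hz y hy h => hinj hz hy (by rw [hq, hq] at h; exact sub_left_injective h)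
  have hopen : IsOpen (q '' ball 0 1) := by
    rcases hqa.is_constant_or_isOpen (convex_ball 0 1).isPreconnected with ⟨c, hc⟩ | h
    · have h₂ : (1 / 2 : ℂ) ∈ ball (0 : ℂ) 1 := by
        rw [mem_ball_zero_iff]; norm_num
      have := hqinj 0 h00 _ h₂ (by rw [hc _ h00, hc _ h₂])
      norm_num at this
    · exact h _ Subset.rfl isOpen_ball
  -- The square root `q` of `f - ω` never takes both a value and its negative. Its image contains a
  -- ball about `q 0`, so `q` stays at distance at least `ρ` from `-q 0`, and a Möbius map with pole
  -- there makes it bounded.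
  obtain ⟨ρ, hρ, hball⟩ := Metric.isOpen_iff.1 hopen (q 0) (mem_image_of_mem q h00)
  have hfar : ∀ z ∈ ball (0 : ℂ) 1, ρ ≤ ‖q z + q 0‖ := by
    intro z hz
    by_contra! hlt
    obtain ⟨y, hy, hyz⟩ : -q z ∈ q '' ball 0 1 := hball (by
      rw [mem_ball, dist_eq_norm, ← norm_neg]
      simpa [add_comm] using hlt)
    have : y = z := hqinj y hy z hz (by rw [hyz]; ring)
    rw [this] at hyz
    exact hq0 z hz (self_eq_neg.1 hyz)
  have hne : ∀ z ∈ ball (0 : ℂ) 1, q z + q 0 ≠ 0 := fun z hz =>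
    norm_pos_iff.1 (hρ.trans_le (hfar z hz))
  set K : ℝ := 1 + ‖q 0‖ / ρ with hK
  have hKpos : 0 < K := by positivity
  have hKc : (K : ℂ) ≠ 0 := by exact_mod_cast hKpos.ne'
  have hu : ∀ z ∈ ball (0 : ℂ) 1, q z / (q z + q 0) = 1 - q 0 / (q z + q 0) := fun z hz => by
    rw [eq_sub_iff_add_eq, ← add_div, div_self (hne z hz)]
  refine ⟨fun z => q z / (q z + q 0) / K, ?_, ?_, ?_, ?_, (1 / (ρ * K)) ^ 2, ?_⟩
  · exact (hqa.differentiableOn.div (hqa.differentiableOn.add_const _) hne).div_const _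
  · intro z hz y hy h
    simp only [div_left_inj' hKc, hu z hz, hu y hy, sub_right_inj] at h
    rw [div_eq_div_iff (hne z hz) (hne y hy)] at h
    have := mul_left_cancel₀ (hq0 0 h00) h
    exact hqinj z hz y hy (by rw [add_right_cancel this])
  · intro z hz
    rw [norm_div, Complex.norm_real, Real.norm_of_nonneg hKpos.le, div_le_one hKpos, hu z hz]
    refine (norm_sub_le _ _).trans ?_
    rw [norm_one, norm_div, hK]
    gcongr
    exact hfar z hz
  · exact div_ne_zero (div_ne_zero (hq0 0 h00) (hne 0 h00)) hKc
  · intro z hz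
    rw [← hq z, norm_pow, ← mul_pow]
    refine pow_le_pow_left₀ (norm_nonneg _) ?_ 2
    rw [norm_div, norm_div, Complex.norm_real, Real.norm_of_nonneg hKpos.le, div_div,
      one_div_mul_eq_div]
    gcongr
    exact hfar z hz

end NoiseSeries

namespace NoiseSeries

/-! ### Boundary values at omitted points -/

/-- Arbitrarily small members of a decreasing family of intervals, all longer than `d`, contain a
translate of each `θ` by an `m`-th part of a period, the number of the part not depending on the
member. -/
theorem exists_rotation_index {Θ : ℝ → Set ℝ} (hmono : ∀ a b, a ≤ b → Θ a ⊆ Θ b)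
    (hord : ∀ δ, (Θ δ).OrdConnected) {d : ℝ} (hd : 0 < d)
    (hlen : ∀ δ > 0, ∃ a ∈ Θ δ, ∃ b ∈ Θ δ, d ≤ b - a) :
    ∃ m : ℕ, 0 < m ∧ ∀ θ : ℝ, ∃ i < m, ∀ δ > 0, ∃ n : ℤ,
      θ + 2 * Real.pi * (i / m + n) ∈ Θ δ := by
  -- With cells of length T = 2π/m < d/2, an interval of length `d` contains a whole cell.
  obtain ⟨m, hm⟩ := exists_nat_gt (4 * Real.pi / d)
  have hπ := Real.pi_pos
  have hm0 : (0 : ℝ) < m := lt_of_le_of_lt (by positivity) hm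
  have hmpos : 0 < m := by exact_mod_cast hm0
  have : NeZero m := ⟨hmpos.ne'⟩
  set T : ℝ := 2 * Real.pi / m with hT
  have hT0 : 0 < T := by positivity
  have hTd : 2 * T < d := by
    rw [div_lt_iff₀ hd] at hm
    rw [hT, ← mul_div_assoc, div_lt_iff₀ hm0]
    linarith
  let Q : ℝ → ZMod m → Prop := fun δ j => ∃ k : ℤ, (k : ZMod m) = j ∧
    Icc (k * T) ((k + 1) * T) ⊆ Θ δ
  have hQ : ∀ δ > 0, ∃ j, Q δ j := by
    intro δ hδ
    obtain ⟨a, ha, b, hb, hab⟩ := hlen δ hδ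
    refine ⟨_, ⌈a / T⌉, rfl, (Icc_subset_Icc ?_ ?_).trans ((hord δ).out ha hb)⟩
    · rw [← div_le_iff₀ hT0]
      exact Int.le_ceil _
    · have := (Int.ceil_lt_add_one (a / T)).le
      rw [← sub_le_iff_le_add, le_div_iff₀ hT0] at this
      linarith
  -- Pigeonhole over the residues mod `m`: one class of cells serves arbitrarily small δ, hence
  -- every δ by monotonicity.
  obtain ⟨j, hj⟩ : ∃ j, ∃ᶠ δ in 𝓝[>] (0 : ℝ), Q δ j := by
    by_contra! h
    have h' : ∀ᶠ δ in 𝓝[>] (0 : ℝ), ∀ j, ¬ Q δ j := eventually_all.2 fun j => h j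
    obtain ⟨δ, h1, h2⟩ := (h'.and self_mem_nhdsWithin).exists
    obtain ⟨j, hj⟩ := hQ δ h2
    exact h1 j hj
  refine ⟨m, hmpos, fun θ => ⟨(j - (⌊θ / T⌋ : ℤ)).val, ZMod.val_lt _, fun δ hδ => ?_⟩⟩
  obtain ⟨δ', ⟨k, hk, hsub⟩, hδ'⟩ := (hj.and_eventually
    (mem_nhdsWithin_of_mem_nhds (Iio_mem_nhds hδ))).exists
  set i := (j - (⌊θ / T⌋ : ℤ)).val with hi
  have hdvd : (m : ℤ) ∣ (k - ⌊θ / T⌋) - i := by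
    rw [← ZMod.intCast_zmod_eq_zero_iff_dvd]
    push_cast
    rw [hi, ZMod.natCast_zmod_val, hk, sub_self]
  obtain ⟨n, hn⟩ := hdvd
  refine ⟨n, hmono _ _ (le_of_lt hδ') (hsub ?_)⟩
  have hn' : (k : ℝ) - ⌊θ / T⌋ = i + m * n := by
    have : (k : ℝ) - ⌊θ / T⌋ - i = m * n := by exact_mod_cast hn
    linarith
  have heq : θ + 2 * Real.pi * (i / m + n) = (θ / T - ⌊θ / T⌋ + k) * T := by
    have h1 : 2 * Real.pi * (i / m + n) = (i + m * n) * T := by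
      rw [hT]; field_simp
    rw [h1, ← hn']
    field_simp
    ring
  have h1 := Int.floor_le (θ / T)
  have h2 := Int.lt_floor_add_one (θ / T)
  rw [heq]
  constructor
  · exact mul_le_mul_of_nonneg_right (by linarith) hT0.le
  · exact mul_le_mul_of_nonneg_right (by linarith) hT0.le

/-- Go radially to the circle, along it, and radially back. Near the circle, oscillation of values
thus forces oscillation of arguments. -/
theorem norm_sub_le_of_eq_exp {z z' l l' : ℂ} (h : Complex.exp l = z) (h' : Complex.exp l' = z')
    (hz : ‖z‖ ≤ 1) (hz' : ‖z'‖ ≤ 1) :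
    ‖z - z'‖ ≤ (1 - ‖z‖) + (1 - ‖z'‖) + |l.im - l'.im| := by
  have key : ∀ z l : ℂ, Complex.exp l = z → ‖z‖ ≤ 1 →
      ‖z - Complex.exp (l.im * Complex.I)‖ = 1 - ‖z‖ := by
    intro z l h hz
    have : z = ‖z‖ * Complex.exp (l.im * Complex.I) := by
      rw [← h, Complex.norm_exp, Complex.ofReal_exp, ← Complex.exp_add, Complex.re_add_im]
    have h2 : z - Complex.exp (l.im * Complex.I) =
        ((‖z‖ - 1 : ℝ) : ℂ) * Complex.exp (l.im * Complex.I) := by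
      conv_lhs => rw [this]
      push_cast; ring
    rw [h2, norm_mul, Complex.norm_exp_ofReal_mul_I, mul_one, Complex.norm_real, Real.norm_eq_abs,
      abs_of_nonpos (by linarith)]
    ring
  have h3 : ‖Complex.exp (l.im * Complex.I) - Complex.exp (l'.im * Complex.I)‖ ≤
      |l.im - l'.im| := by
    have : Complex.exp (l.im * Complex.I) - Complex.exp (l'.im * Complex.I) =
        Complex.exp (l'.im * Complex.I) *
          (Complex.exp (Complex.I * ((l.im - l'.im : ℝ) : ℂ)) - 1) := by
      rw [mul_sub, ← Complex.exp_add, mul_one]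
      congr 2
      push_cast; ring
    rw [this, norm_mul, Complex.norm_exp_ofReal_mul_I, one_mul]
    exact Real.norm_exp_I_mul_ofReal_sub_one_le
  calc ‖z - z'‖ = ‖(z - Complex.exp (l.im * Complex.I)) +
        (Complex.exp (l.im * Complex.I) - Complex.exp (l'.im * Complex.I)) -
        (z' - Complex.exp (l'.im * Complex.I))‖ := by congr 1; ring
    _ ≤ _ := norm_sub_le _ _
    _ ≤ _ := add_le_add_left (norm_add_le _ _) _
    _ ≤ _ := by rw [key z l h hz, key z' l' h' hz']; linarith

namespace DiskBranch

variable {f g : ℂ → ℂ} {B : Set ℂ}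

/-- Without a limit, the images under `g` of the lenses at `ω` approach the circle while their
arguments fill intervals of length at least `d / 2`. On these images `f` is close to `ω`, so the
bounded companion `u` is small along a rotation of every radius and vanishes at 0, a contradiction.
-/
theorem exists_tendsto_of_forall_ne (H : DiskBranch f g B) (hinj : InjOn f (ball 0 1)) {ω : ℂ}
    (hω : ω ∈ B) (hne : ∀ z ∈ ball (0 : ℂ) 1, f z ≠ ω) :
    ∃ ζ, Tendsto g (𝓝[ball 0 1] ω) (𝓝 ζ) := by
  have hωs := H.subset_sphere hω
  have := neBot_nhdsWithin_unitBall (sphere_subset_closedBall hωs)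
  by_contra hno
  obtain ⟨u, hud, hui, hub, hu0, c, huc⟩ := exists_bounded_univalent H.differentiableOn hinj hne
  refine hu0 ?_
  -- `g` oscillates near `ω`
  obtain ⟨d, hd, hosc⟩ : ∃ d > 0, ∀ δ > 0, ∃ w ∈ ball (0 : ℂ) 1 ∩ ball ω δ,
      ∃ w' ∈ ball (0 : ℂ) 1 ∩ ball ω δ, d ≤ ‖g w - g w'‖ := by
    have hnc : ¬ Cauchy (map g (𝓝[ball 0 1] ω)) := fun h => hno (cauchy_map_iff_exists_tendsto.1 h)
    rw [Metric.cauchy_iff] at hnc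
    push Not at hnc
    obtain ⟨d, hd, h⟩ := hnc (this.map g)
    refine ⟨d, hd, fun δ hδ => ?_⟩
    obtain ⟨x, hx, y, hy, hxy⟩ := h (g '' (ball (0 : ℂ) 1 ∩ ball ω δ)) (image_mem_map
      (inter_mem_nhdsWithin _ (ball_mem_nhds ω hδ)))
    obtain ⟨w, hw, rfl⟩ := hx
    obtain ⟨w', hw', rfl⟩ := hy
    exact ⟨w, hw, w', hw', by rwa [← dist_eq_norm]⟩
  -- a continuous logarithm of `g` near `ω`
  have hS : Convex ℝ (ball (0 : ℂ) 1 ∩ ball ω 1) := (convex_ball _ _).inter (convex_ball _ _)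
  have hSne : (ball (0 : ℂ) 1 ∩ ball ω 1).Nonempty :=
    let ⟨w, hw, _⟩ := hosc 1 one_pos
    ⟨w, hw⟩
  obtain ⟨L, hLc, hL⟩ := Complex.exists_continuousOn_eqOn_exp_comp
    (isSimplyConnected_of_convex hS hSne) (isOpen_ball.inter isOpen_ball)
    (H.continuousOn.mono inter_subset_left) (by
      rintro ⟨w, hw, hw0⟩
      have : w = 0 := H.injOn_branch hw.1 (mem_ball_self one_pos) (hw0.trans H.map_zero.symm)
      rw [this] at hw
      exact (mem_ball'.1 hw.2).ne (mem_sphere.1 hωs))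
  have hone : ∀ δ : ℝ, ball (0 : ℂ) 1 ∩ ball ω (min δ 1) ⊆ ball (0 : ℂ) 1 ∩ ball ω 1 := fun δ =>
    inter_subset_inter_right _ (ball_subset_ball (min_le_right _ _))
  -- the arguments of `g` near `ω`
  set Θ : ℝ → Set ℝ := fun δ => (fun w => (L w).im) '' (ball (0 : ℂ) 1 ∩ ball ω (min δ 1))
  have hsmall : ∀ a < (1 : ℝ), ∃ δ₀ > 0, ∀ w ∈ ball (0 : ℂ) 1 ∩ ball ω δ₀, a < ‖g w‖ := by
    intro a ha
    obtain ⟨δ₀, hδ₀, h⟩ := Metric.mem_nhdsWithin_iff.1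
      ((tendsto_order.1 (H.tendsto_norm_branch hω)).1 a ha)
    exact ⟨δ₀, hδ₀, fun w hw => h ⟨hw.2, hw.1⟩⟩
  have hle : ∀ w ∈ ball (0 : ℂ) 1, ‖g w‖ < 1 := fun w hw => mem_ball_zero_iff.1 (H.mapsTo hw)
  obtain ⟨m, hm, hidx⟩ := exists_rotation_index (Θ := Θ) (d := d / 2)
    (fun a b hab => image_mono (inter_subset_inter_right _ (ball_subset_ball
      (min_le_min_right _ hab))))
    (fun δ => (IsPreconnected.image ((convex_ball _ _).inter (convex_ball _ _)).isPreconnected _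
      (Complex.continuous_im.comp_continuousOn (hLc.mono (hone δ)))).ordConnected)
    (half_pos hd) (by
      intro δ hδ
      -- The two moduli account for less than `d / 4` each, leaving `d / 2` to the arguments.
      obtain ⟨δ₀, hδ₀, h₀⟩ := hsmall (1 - d / 4) (by linarith)
      obtain ⟨w, hw, w', hw', hd'⟩ := hosc (min (min δ 1) δ₀) (by positivity)
      have hsub := inter_subset_inter_right (ball (0 : ℂ) 1)
        (ball_subset_ball (x := ω) (min_le_left (min δ 1) δ₀))
      have hsub' := inter_subset_inter_right (ball (0 : ℂ) 1)
        (ball_subset_ball (x := ω) (min_le_right (min δ 1) δ₀))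
      have hn := norm_sub_le_of_eq_exp (hL (hone δ (hsub hw))) (hL (hone δ (hsub hw')))
        (hle w hw.1).le (hle w' hw'.1).le
      have h1 := h₀ w (hsub' hw)
      have h2 := h₀ w' (hsub' hw')
      rcases abs_cases ((L w).im - (L w').im) with h | h
      · exact ⟨_, mem_image_of_mem _ (hsub hw'), _, mem_image_of_mem _ (hsub hw), by linarith⟩
      · exact ⟨_, mem_image_of_mem _ (hsub hw), _, mem_image_of_mem _ (hsub hw'), by linarith⟩)
  have hmc : (m : ℂ) ≠ 0 := by exact_mod_cast hm.ne'
  refine eq_zero_of_rotations_radially_small hud hui hub (m := m)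
    (η := Complex.exp ((2 * Real.pi / m : ℝ) * Complex.I)) (Complex.norm_exp_ofReal_mul_I _)
    fun θ => ?_
  obtain ⟨i, hi, hδ⟩ := hidx θ
  refine ⟨i, hi, fun r hr ε hε => ?_⟩
  obtain ⟨δ₀, hδ₀, h₀⟩ := hsmall r hr
  have hcpos : 0 < |c| + 1 := by positivity
  -- This radius turns ‖u‖² ≤ c ‖f - ω‖ into ‖u‖ ≤ ε. The point on the rotated radius is `g w`, so
  -- `s = ‖g w‖`.
  obtain ⟨n, w, hw, hwθ⟩ := hδ (min δ₀ (ε ^ 2 / (|c| + 1))) (by positivity)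
  have hwS := hone _ hw
  have hwδ : dist w ω < min (min δ₀ (ε ^ 2 / (|c| + 1))) 1 := hw.2
  have hgw : Complex.exp ((2 * Real.pi / m : ℝ) * Complex.I) ^ i *
      (‖g w‖ * Complex.exp (θ * Complex.I)) = g w := by
    have h1 : g w = ‖g w‖ * Complex.exp ((L w).im * Complex.I) := by
      rw [← hL hwS, Function.comp_apply, Complex.norm_exp, Complex.ofReal_exp, ← Complex.exp_add,
        Complex.re_add_im]
    simp only at hwθ
    conv_rhs => rw [h1, hwθ]
    have h2 : ((θ + 2 * Real.pi * (i / m + n) : ℝ) : ℂ) * Complex.I =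
        i * ((2 * Real.pi / m : ℝ) * Complex.I) + θ * Complex.I + n * (2 * Real.pi * Complex.I) := by
      push_cast
      field_simp
      ring
    rw [h2, Complex.exp_add, Complex.exp_int_mul_two_pi_mul_I, Complex.exp_add, Complex.exp_nat_mul]
    ring
  refine ⟨‖g w‖, h₀ w ⟨hw.1, hwδ.trans_le ((min_le_left _ _).trans (min_le_left _ _))⟩,
    hle w hw.1, norm_nonneg _, ?_⟩
  rw [hgw]
  refine (sq_le_sq₀ (norm_nonneg _) hε.le).1 ((huc _ (H.mapsTo hw.1)).trans ?_)
  rw [H.rightInv w hw.1, ← dist_eq_norm]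
  have h3 : dist w ω < ε ^ 2 / (|c| + 1) :=
    hwδ.trans_le ((min_le_left _ _).trans (min_le_right _ _))
  rw [lt_div_iff₀ hcpos] at h3
  nlinarith [le_abs_self c, dist_nonneg (x := w) (y := ω)]

theorem continuousOn_closedBall (H : DiskBranch f g B)
    (hlim : ∀ ω ∈ B, ∃ ζ, Tendsto g (𝓝[ball 0 1] ω) (𝓝 ζ)) :
    ContinuousOn (diskExtend g) (closedBall 0 1) := by
  refine continuousOn_extendFrom (fun _ => mem_closure_unitBall) fun w hw => ?_
  by_cases hB : w ∈ B
  · exact hlim w hB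
  · obtain ⟨z, -, hz⟩ := H.exists_tendsto hw hB
    exact ⟨z, hz⟩

theorem valueCurve_eq_image (H : DiskBranch f g B)
    (hlim : ∀ ω ∈ B, ∃ ζ, Tendsto g (𝓝[ball 0 1] ω) (𝓝 ζ)) :
    valueCurve g B = diskExtend g '' sphere 0 1 := by
  have hc := (H.continuousOn_closedBall hlim).mono sphere_subset_closedBall
  refine Subset.antisymm (closure_minimal (image_mono sdiff_subset)
    ((isCompact_sphere 0 1).image_of_continuousOn hc).isClosed) ?_
  have hs : sphere (0 : ℂ) 1 = closure (sphere 0 1 \ B) := Subset.antisymm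
    (fun _ => H.mem_closure_sphere_diff) (closure_minimal sdiff_subset isClosed_sphere)
  rw [hs] at hc
  conv_lhs => rw [hs]
  exact hc.image_closure

theorem setOf_norm_eq_one (H : DiskBranch f g B) (hinj : InjOn f (ball 0 1))
    (hne : ∀ z ∈ ball (0 : ℂ) 1, f z ∉ B) :
    {z ∈ ball (0 : ℂ) 1 | ‖f z‖ = 1} = diskExtend g '' (sphere 0 1 \ B) := by
  ext z
  constructor
  · rintro ⟨hz, hz1⟩
    have hs : f z ∈ sphere (0 : ℂ) 1 := mem_sphere_zero_iff_norm.2 hz1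
    have hc := sphere_subset_closedBall hs
    exact ⟨f z, ⟨hs, hne z hz⟩, hinj (H.diskExtend_mem hc (hne z hz)) hz
      (H.apply_diskExtend hc (hne z hz))⟩
  · rintro ⟨w, hw, rfl⟩
    have hc := sphere_subset_closedBall hw.1
    refine ⟨H.diskExtend_mem hc hw.2, ?_⟩
    rw [H.apply_diskExtend hc hw.2]
    exact mem_sphere_zero_iff_norm.1 hw.1

end DiskBranch

end NoiseSeries

namespace NoiseSeries

/-! ### Uniformizations -/

/-- The local inverse `s` is continuous, so `f` is not locally constant and critical points are
isolated. Hence `s` is holomorphic off one point, where the singularity is removable, and the chain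
rule for `f ∘ s = id` excludes a zero derivative. -/
theorem deriv_ne_zero_of_isLocalHomeomorph {f : ℂ → ℂ} (hf : DifferentiableOn ℂ f (ball 0 1))
    (hl : IsLocalHomeomorph fun z : ball (0 : ℂ) 1 => f z) {z : ℂ} (hz : z ∈ ball (0 : ℂ) 1) :
    deriv f z ≠ 0 := by
  intro h0
  obtain ⟨e, hze, he⟩ := hl ⟨z, hz⟩
  set s : ℂ → ℂ := fun w => (e.symm w : ℂ) with hs
  have hfs : ∀ w ∈ e.target, f (s w) = w := fun w hw => by
    have h1 := e.right_inv hw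
    rwa [← he] at h1
  have hsc : ∀ w ∈ e.target, ContinuousAt s w := fun w hw =>
    continuous_subtype_val.continuousAt.comp (e.continuousAt_symm hw)
  have hct : f z ∈ e.target := by
    have := e.map_source hze
    rwa [← he] at this
  have hcs : s (f z) = z := by
    have := e.left_inv hze
    rw [← he] at this
    exact congrArg Subtype.val this
  have htgt : ∀ᶠ w in 𝓝 (f z), w ∈ e.target := e.open_target.mem_nhds hct
  have hlim : Tendsto s (𝓝 (f z)) (𝓝 z) := by simpa [hcs] using (hsc _ hct).tendsto
  have hd : ∀ y ∈ ball (0 : ℂ) 1, HasDerivAt f (deriv f y) y := fun y hy =>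
    hf.hasDerivAt (isOpen_ball.mem_nhds hy)
  rcases (hf.analyticAt (isOpen_ball.mem_nhds hz)).deriv.eventually_eq_zero_or_eventually_ne_zero
    with h | h
  · obtain ⟨ρ, hρ, hsub⟩ := Metric.eventually_nhds_iff_ball.1
      (h.and (isOpen_ball.eventually_mem hz))
    have hconst : ∀ y ∈ ball z ρ, f y = f z := fun y hy =>
      isOpen_ball.is_const_of_deriv_eq_zero (convex_ball z ρ).isPreconnected
        (fun y hy => (hd y (hsub y hy).2).differentiableAt.differentiableWithinAt)
        (fun y hy => (hsub y hy).1) hy (mem_ball_self hρ)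
    have hev : ∀ᶠ w in 𝓝[≠] (f z), w = f z := by
      filter_upwards [nhdsWithin_le_nhds htgt,
        nhdsWithin_le_nhds (hlim.eventually_mem (ball_mem_nhds z hρ))] with w hw hwz
      rw [← hconst _ hwz, hfs w hw]
    obtain ⟨w, hw, hne⟩ := (hev.and self_mem_nhdsWithin).exists
    exact hne hw
  · have hs' : Tendsto s (𝓝[≠] (f z)) (𝓝[≠] z) := by
      refine tendsto_nhdsWithin_iff.2 ⟨hlim.mono_left nhdsWithin_le_nhds, ?_⟩
      filter_upwards [nhdsWithin_le_nhds htgt, self_mem_nhdsWithin] with w hw hne hwz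
      exact hne (by rw [mem_singleton_iff, ← hfs w hw, hwz])
    have hsa : AnalyticAt ℂ s (f z) := by
      refine Complex.analyticAt_of_differentiable_on_punctured_nhds_of_continuousAt ?_ (hsc _ hct)
      filter_upwards [hs'.eventually h, nhdsWithin_le_nhds htgt] with w hw hwt
      refine (HasDerivAt.of_local_left_inverse (hsc w hwt) (hd _ (e.symm w).2) hw
        ?_).differentiableAt
      filter_upwards [e.open_target.mem_nhds hwt] with y hy using hfs y hy
    have h1 : HasDerivAt (f ∘ s) (0 * deriv s (f z)) (f z) :=
      HasDerivAt.comp _ (by rw [hcs, ← h0]; exact hd z hz) hsa.differentiableAt.hasDerivAt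
    have h2 : HasDerivAt (f ∘ s) 1 (f z) := (hasDerivAt_id _).congr_of_eventuallyEq
      (htgt.mono fun w hw => hfs w hw)
    have := h1.unique h2
    simp at this

variable {Ω : Type*} [TopologicalSpace Ω] [ChartedSpace ℂ Ω]

namespace Uniformization

variable {S : FirstSheet Ω} (U : Uniformization S)

/-- The inverse of the covering map with values in the disk as a subtype. -/
def psiBall (p : Ω) : ball (0 : ℂ) 1 := ⟨U.psi p, U.psi_mem p⟩

theorem continuousOn_unif : ContinuousOn U.unif (ball 0 1) :=
  U.mdifferentiableOn_unif.continuousOn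

theorem continuousOn_psi_sheet : ContinuousOn (U.psi ∘ S.sheet) (ball 0 1) :=
  U.continuousOn_psi.comp S.continuousOn_sheet (mapsTo_image _ _)

theorem differentiableOn_phi : DifferentiableOn ℂ U.phi (ball 0 1) :=
  mdifferentiableOn_iff_differentiableOn.1
    (S.mdifferentiable_proj.comp_mdifferentiableOn U.mdifferentiableOn_unif)

/-- Over an evenly covered neighbourhood of `p` there is a continuous section `G` in the same sheet
of the covering as ψ at one point `a`. By uniqueness of lifts on a convex lens, ψ on the first sheet
is `G ∘ S.sheet`, which tends to `G p`. -/
theorem tendsto_psi_sheet {ω : ℂ} {p : Ω} (hω : ω ∈ sphere (0 : ℂ) 1)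
    (h : Tendsto S.sheet (𝓝[ball 0 1] ω) (𝓝 p)) :
    ∃ z ∈ ball (0 : ℂ) 1, Tendsto (U.psi ∘ S.sheet) (𝓝[ball 0 1] ω) (𝓝 z) := by
  have hcov := U.isCoveringMap_unif
  have := (U.isCoveringMap_unif p).discreteTopology_fiber
  have : Nonempty ((fun z : ball (0 : ℂ) 1 => U.unif z) ⁻¹' {p}) :=
    ⟨⟨U.psiBall p, U.unif_psi p⟩⟩
  set t := (U.isCoveringMap_unif p).toTrivialization
  have hp : p ∈ t.baseSet := (U.isCoveringMap_unif p).mem_toTrivialization_baseSet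
  obtain ⟨δ, hδ, hsub⟩ := Metric.mem_nhdsWithin_iff.1 (h (t.open_baseSet.mem_nhds hp))
  set A : Set ℂ := ball ω δ ∩ ball 0 1 with hA
  have hnb := neBot_nhdsWithin_unitBall (sphere_subset_closedBall hω)
  have hAω : A ∈ 𝓝[ball 0 1] ω := by
    rw [hA, inter_comm]; exact inter_mem_nhdsWithin _ (ball_mem_nhds ω hδ)
  obtain ⟨a, ha⟩ := hnb.nonempty_of_mem hAω
  have hmem : ∀ x, ∀ y ∈ t.baseSet, (y, x) ∈ t.target := fun x y hy => by rwa [t.mem_target]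
  set G : Ω → ball (0 : ℂ) 1 := fun q =>
    t.toOpenPartialHomeomorph.symm (q, (t (U.psiBall (S.sheet a))).2) with hG
  have hGc : ContinuousOn G t.baseSet :=
    t.toOpenPartialHomeomorph.continuousOn_symm.comp (by fun_prop) fun y hy => hmem _ y hy
  have hUG : ∀ q ∈ t.baseSet, U.unif (G q) = q := fun q hq => t.proj_symm_apply' hq
  have heq : EqOn (fun w => G (S.sheet w)) (fun w => U.psiBall (S.sheet w)) A := by
    refine hcov.eqOn_of_comp_eqOn ((convex_ball _ _).inter (convex_ball _ _)).isPreconnected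
      (hGc.comp (S.continuousOn_sheet.mono inter_subset_right) hsub)
      (Topology.IsInducing.subtypeVal.continuousOn_iff.2
        (U.continuousOn_psi_sheet.mono inter_subset_right)) ?_ ha ?_
    · intro w hw
      simp only [Function.comp_apply]
      rw [hUG _ (hsub hw)]
      exact (U.unif_psi _).symm
    · have h1 : U.psiBall (S.sheet a) ∈ t.source := by
        rw [t.mem_source]
        simp only [psiBall, U.unif_psi]
        exact hsub ha
      have h2 : (S.sheet a, (t (U.psiBall (S.sheet a))).2) = t (U.psiBall (S.sheet a)) := by
        refine Prod.ext ?_ rfl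
        exact (U.unif_psi _).symm.trans (t.proj_toFun _ h1).symm
      simp only [hG]
      rw [h2]
      exact t.toOpenPartialHomeomorph.left_inv h1
  refine ⟨G p, (G p).2, ?_⟩
  have hlim : Tendsto (fun w => ((G (S.sheet w) : ball (0 : ℂ) 1) : ℂ)) (𝓝[ball 0 1] ω)
      (𝓝 (G p)) :=
    (continuous_subtype_val.tendsto _).comp
      ((hGc.continuousAt (t.open_baseSet.mem_nhds hp)).tendsto.comp h)
  refine hlim.congr' ?_
  filter_upwards [hAω] with w hw
  exact congrArg Subtype.val (heq hw)

theorem diskBranch (hS : S.singularPoints.Finite) :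
    DiskBranch U.phi (U.psi ∘ S.sheet) S.singularPoints where
  differentiableOn := U.differentiableOn_phi
  deriv_ne_zero z hz := deriv_ne_zero_of_isLocalHomeomorph U.differentiableOn_phi
    (S.isLocalHomeomorph_proj.comp U.isCoveringMap_unif.isLocalHomeomorph) hz
  continuousOn := U.continuousOn_psi_sheet
  mapsTo w _ := U.psi_mem _
  rightInv w hw := by
    rw [phi, Function.comp_apply, U.unif_psi, S.proj_sheet w hw]
  map_zero := U.psi_zero
  mem_iff ω := by
    refine and_congr_right fun hω => not_congr ⟨fun ⟨p, hp⟩ => U.tendsto_psi_sheet hω hp, ?_⟩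
    rintro ⟨z, hz, h⟩
    refine ⟨U.unif z, ?_⟩
    refine ((U.continuousOn_unif.continuousAt (isOpen_ball.mem_nhds hz)).tendsto.comp h).congr
      fun w => U.unif_psi _
  finite := hS

/-- The identity of Ω lifts to a continuous section of the covering, and uniqueness of lifts makes
it a left inverse as well. -/
theorem injOn_unif [SimplyConnectedSpace Ω] : InjOn U.unif (ball 0 1) := by
  have := ChartedSpace.locallyPathConnectedSpace ℂ Ω
  obtain ⟨s, ⟨hs0, hs⟩, -⟩ := U.isCoveringMap_unif.existsUnique_continuousMap_lifts
    (ContinuousMap.id Ω) (S.sheet 0) (U.psiBall (S.sheet 0)) (U.unif_psi _)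
  have hconn : PreconnectedSpace (ball (0 : ℂ) 1) :=
    isPreconnected_iff_preconnectedSpace.1 (convex_ball _ _).isPreconnected
  have hs' : ∀ q, U.unif (s q) = q := fun q => congrFun hs q
  have key := U.isCoveringMap_unif.eq_of_comp_eq
    (g₁ := fun z : ball (0 : ℂ) 1 => s (U.unif z)) (g₂ := id)
    (s.continuous.comp U.isCoveringMap_unif.continuous) continuous_id
    (funext fun z => hs' _) (U.psiBall (S.sheet 0))
    (by simp only [id, psiBall, U.unif_psi]; exact hs0)
  intro x hx y hy hxy
  have h1 := congrFun key ⟨x, hx⟩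
  have h2 := congrFun key ⟨y, hy⟩
  simp only [id] at h1 h2
  rw [hxy] at h1
  exact congrArg Subtype.val (h1.symm.trans h2)

/-- An injective coordinate is an open embedding, so convergence can be tested in ℂ: the first sheet
tends to `U.unif z` at the point `U.phi z`. -/
theorem phi_notMem_singularPoints (hinj : Function.Injective S.proj) (z : ℂ) :
    U.phi z ∉ S.singularPoints := by
  rintro ⟨-, h⟩
  refine h ⟨U.unif z, ?_⟩
  have hemb : IsOpenEmbedding S.proj :=
    .of_continuous_injective_isOpenMap S.isLocalHomeomorph_proj.continuous hinj
      S.isLocalHomeomorph_proj.isOpenMap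
  rw [hemb.tendsto_nhds_iff]
  have hid : Tendsto id (𝓝[ball 0 1] (U.phi z)) (𝓝 (U.phi z)) :=
    tendsto_id.mono_left nhdsWithin_le_nhds
  refine hid.congr' ?_
  filter_upwards [self_mem_nhdsWithin] with w hw using (S.proj_sheet w hw).symm

end Uniformization

end NoiseSeries

namespace NoiseSeries

/-! ### Natural boundaries of random series -/

theorem ae_noise_not_regular_of_isUniform {X : Type*} [MeasurableSpace X] (P : Measure X)
    {r : ℕ → X → ℝ} (hr : ∀ k, Measurable (r k))
    (hunif : ∀ k, pdf.IsUniform (r k) (Icc (-1 : ℝ) 1) P volume) (hindep : iIndepFun r P)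
    {ε : ℝ} (hε : 0 < ε) : ∀ᵐ x ∂P, (∀ k, |r k x| ≤ 1) ∧
      ∀ ζ ∈ sphere (0 : ℂ) 1, ¬ IsRegularPoint (noise ε fun k => r k x) (ball 0 1) ζ := by
  have hmap : P.map (fun x k => r k x) = uniformSequence := by
    rw [hindep.map_fun_eq_infinitePi_map hr, uniformSequence]
    exact congrArg Measure.infinitePi (funext hunif)
  have h := ae_noise_not_regular hε
  rw [← hmap] at h
  exact ae_of_ae_map (measurable_pi_iff.2 hr).aemeasurable h

end NoiseSeries

end

/-! ### The corollary -/

open NoiseSeries in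
theorem corollary4p5
    {Ω : Type*} [TopologicalSpace Ω] [T2Space Ω] [ConnectedSpace Ω]
    [ChartedSpace ℂ Ω] [IsManifold 𝓘(ℂ) 1 Ω]
    (S : FirstSheet Ω) (hS : S.singularPoints.Finite) (U : Uniformization S)
    {X : Type*} [MeasurableSpace X] (P : Measure X) [IsProbabilityMeasure P]
    (r : ℕ → X → ℝ) (hr : ∀ k, Measurable (r k))
    (hunif : ∀ k, pdf.IsUniform (r k) (Icc (-1 : ℝ) 1) P volume)
    (hindep : iIndepFun r P)
    (ε : ℝ) (hε : 0 < ε) :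
    -- almost surely, the unit circle is a natural boundary of the noise series
    (∀ᵐ x ∂P, IsNaturalBoundary (noise ε (fun k => r k x)) (ball 0 1) (sphere 0 1)) ∧
    -- almost surely, `ψ(S¹)` is a natural boundary of the noise series composed with `φ`
    (∀ᵐ x ∂P, IsNaturalBoundary (fun z => noise ε (fun k => r k x) (U.phi z))
      U.imageDisk U.boundaryCurve) ∧
    -- `ψ(S¹)` consists of regular analytic arcs, the images of the arcs of `S¹` inside `Ω`, ...
    (InjOn U.psiSheet (sphere 0 1 \ S.singularPoints) ∧
      (∀ θ : ℝ, Complex.exp (θ * Complex.I) ∉ S.singularPoints →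
        AnalyticAt ℝ (fun t : ℝ => U.psiSheet (Complex.exp (t * Complex.I))) θ ∧
        deriv (fun t : ℝ => U.psiSheet (Complex.exp (t * Complex.I))) θ ≠ 0 ∧
        IsAnalyticArcAt U.boundaryCurve (U.psiSheet (Complex.exp (θ * Complex.I)))) ∧
      U.boundaryCurve ∩ ball 0 1 = U.psiSheet '' (sphere 0 1 \ S.singularPoints)) ∧
    -- ... whose ends lie on the unit circle and correspond to the singular points `ω_i`; the curve
    -- is not analytic at `ψ(ω_i)` when `ω_i` is a singular point of `ψ`
    (∀ ω ∈ S.singularPoints,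
      Tendsto (fun w => ‖U.psiSheet w‖) (𝓝[closedBall 0 1 \ S.singularPoints] ω) (𝓝 1) ∧
      ∀ ζ, Tendsto U.psiSheet (𝓝[ball 0 1] ω) (𝓝 ζ) →
        ζ ∈ U.boundaryCurve ∧
        (¬ IsRegularPoint U.psiSheet (ball 0 1) ω → ¬ IsAnalyticArcAt U.boundaryCurve ζ)) ∧
    -- for a simply connected plane domain all the boundary values `ψ(ω_i)` exist
    (SimplyConnectedSpace Ω → Function.Injective S.proj →
      ContinuousOn U.psiSheet (closedBall 0 1) ∧
      U.boundaryCurve = U.psiSheet '' sphere 0 1 ∧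
      {z ∈ ball (0 : ℂ) 1 | ‖U.phi z‖ = 1} = U.psiSheet '' (sphere 0 1 \ S.singularPoints)) ∧
    -- the minimum of `|z|` over `ψ(S¹)` is attained, it is less than `1`, and almost surely its
    -- inverse is the upper limit of `|n_k| ^ (1 / k)`
    (∃ z ∈ U.boundaryCurve, IsMinOn (fun z => ‖z‖) U.boundaryCurve z) ∧
    ∀ zinf ∈ U.boundaryCurve, IsMinOn (fun z => ‖z‖) U.boundaryCurve zinf →
      ‖zinf‖ < 1 ∧
      ∀ᵐ x ∂P, ∃ n : ℕ → ℂ,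
        (∀ᶠ z in 𝓝 (0 : ℂ),
          HasSum (fun k => n k * z ^ k) (noise ε (fun k => r k x) (U.phi z))) ∧
        limsup (fun k : ℕ => ‖n k‖ₑ ^ (1 / (k : ℝ))) atTop = ‖zinf‖ₑ⁻¹ := by
  -- `U.psiSheet` and `U.boundaryCurve` are by definition `diskExtend` and `valueCurve` of this
  -- branch, so its lemmas apply verbatim.
  have H := U.diskBranch hS
  have hnoise : ∀ᵐ x ∂P, DifferentiableOn ℂ (noise ε (fun k => r k x)) (ball 0 1) ∧
      ∀ ζ ∈ sphere (0 : ℂ) 1, ¬ IsRegularPoint (noise ε (fun k => r k x)) (ball 0 1) ζ :=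
    (ae_noise_not_regular_of_isUniform P hr hunif hindep hε).mono fun x hx =>
      ⟨differentiableOn_noise ε hx.1, hx.2⟩
  refine ⟨hnoise.mono fun x hx => ?_, hnoise.mono fun x hx => ?_, ⟨?_, fun θ hθ => ?_, ?_⟩,
    fun ω hω => ⟨H.tendsto_norm_diskExtend hω, fun ζ hζ => ?_⟩, fun hsc hinj => ?_,
    H.exists_isMinOn, fun zinf hz hmin => ⟨H.norm_lt_one_of_isMinOn hmin, ?_⟩⟩
  · exact ⟨isOpen_ball, (convex_ball (0 : ℂ) 1).isConnected (nonempty_ball.2 one_pos), hx.1,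
      (frontier_ball (0 : ℂ) one_ne_zero).ge, hx.2⟩
  · have := H.isNaturalBoundary_comp hx.1 hx.2
    rwa [← H.image_diskExtend] at this
  · exact H.injOn_diskExtend.mono (sdiff_subset_sdiff_left sphere_subset_closedBall)
  · have hs : Complex.exp (θ * Complex.I) ∈ sphere (0 : ℂ) 1 :=
      mem_sphere_zero_iff_norm.2 (Complex.norm_exp_ofReal_mul_I θ)
    exact ⟨(H.analyticAt_curve hθ).1, (H.analyticAt_curve hθ).2, H.isAnalyticArcAt hs hθ⟩
  · exact H.valueCurve_inter_ball
  · have hlim : Tendsto (U.psi ∘ S.sheet) (𝓝[ball 0 1] ω) (𝓝 ζ) := by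
      refine hζ.congr' ?_
      filter_upwards [self_mem_nhdsWithin] with w hw using H.diskExtend_of_mem hw
    exact ⟨H.mem_valueCurve hω.1 hlim, mt (H.isRegularPoint_of_isAnalyticArcAt hω hlim)⟩
  · have hφ : InjOn U.phi (ball 0 1) := fun x hx y hy h => U.injOn_unif hx hy (hinj h)
    have hlim : ∀ ω ∈ S.singularPoints, ∃ ζ, Tendsto (U.psi ∘ S.sheet) (𝓝[ball 0 1] ω) (𝓝 ζ) :=
      fun ω hω => H.exists_tendsto_of_forall_ne hφ hω fun z _ h =>
        U.phi_notMem_singularPoints hinj z (h ▸ hω)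
    exact ⟨H.continuousOn_closedBall hlim, H.valueCurve_eq_image hlim,
      H.setOf_norm_eq_one hφ fun z _ => U.phi_notMem_singularPoints hinj z⟩
  · refine hnoise.mono fun x hx => ?_
    obtain ⟨p, hp, hrad⟩ := H.exists_taylor_radius_eq hx.1 hx.2 hz hmin
    refine ⟨p.coeff, ?_, by rw [limsup_enorm_coeff_rpow, hrad]⟩
    filter_upwards [hp.eventually_hasSum] with z hsum
    simpa [mul_comm] using hsum
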